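/- Let $n\ge 1$ and let $\tilde S_n$ be the affine symmetric group: the bijections $\pi:\mathbb Z\to\mathbb Z$ with $\pi(i+n)=\pi(i)+n$ for all $i$ and $\sum_{i=1}^n\pi(i)=\sum_{i=1}^n i$. For $i \in \mathbb Z$ let $s_i$ be the element interchanging $i$ and $i+1$ and fixing all integers outside $\{i,i+1\}+n\mathbb Z$ (for $n=1$ the group is trivial and $s_i:=1$). Let $\ell$ be the length function with respect to these generators, and let $\circ$ be the Demazure product, the unique associative product on $\tilde S_n$ with $s_i\circ s_i=s_i$ and $u\circ v=uv$ whenever $\ell(uv)=\ell(u)+\ell(v)$. An element is cyclically decreasing if it has a reduced expression $s_{i_1}\cdots s_{i_l}$ with $s_{i_j+1}\ne s_{i_k}$ for all $j<k$. For $\pi \in \tilde S_n$ let $$F_\pi=\sum_{\pi=\pi^1\pi^2\cdots}x_1^{\ell(\pi^1)}x_2^{\ell(\pi^2)}\cdots,$$ the sum over all factorizations of $\pi$ into countably many (all but finitely many trivial) cyclically decreasing factors with $\ell(\pi)=\sum_i\ell(\pi^i)$. Let $\tilde I_n=\{z\in\tilde S_n: z=z^{-1}\}$. For $z\in\tilde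 I_n$ let $\mathcal A(z)$ be the set of atoms of $z$, that is, the elements of minimal length in $\{\pi\in\tilde S_n:\pi^{-1}\circ\pi=z\}$, let $\hat F_z=\sum_{\pi\in\mathcal A(z)}F_\pi$, and let $\hat\ell(z)=\frac12(\ell(z)+\ell'(z))$, where $\ell'(z)$ is $n$ minus the number of orbits of $z$ on $\mathbb Z/n\mathbb Z$. Let $\mathsf{QSym}\subset\mathbb Q[[x_1,x_2,\dots]]$ be the graded coalgebra of quasi-symmetric functions over $\mathbb Q$, with coproduct $\Delta(M_\alpha)=\sum_{\alpha=\beta\gamma}M_\beta\otimes M_\gamma$ on monomial quasi-symmetric functions, where $\beta\gamma$ denotes concatenation of compositions; it is a graded right comodule for itself. Finally let $P(z)$ be the (finite) set of pairs $(y,\pi)\in\tilde I_n\times\tilde S_n$ with $\hat\ell(z)=\hat\ell(y)+\ell(\pi)$ and $z=\pi^{-1}\circ y\circ\pi$. Then: 1. The vector space $\mathbb Q\tilde I_n$, in which $z\in\tilde I_n$ is homogeneous of degree $\hat\ell(z)$, is a graded right $\mathsf{QSym}$-comodule with coaction $z\mapsto\sum_{(y,\pi)\in P(z)}y\otimes F_\pi$.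 2. The linear map with $z\mapsto\hat F_z$ for $z \in \tilde I_n$ is the unique morphism of graded right $\mathsf{QSym}$-comodules $\mathbb Q\tilde I_n\to\mathsf{QSym}$ satisfying $1\mapsto 1$. 3. For every $z\in\tilde I_n$ one has $\Delta(\hat F_z)=\sum_{(y,\pi)\in P(z)}\hat F_y\otimes F_\pi$. -/

import Mathlib

open scoped TensorProduct

noncomputable section

namespace AffineStanley

/-! Auxiliary facts on maps commuting with translation by `n`. -/

theorem shift_mul {n : ℕ} {π : Equiv.Perm ℤ} (h : ∀ i : ℤ, π (i + n) = π i + n) (i k : ℤ) :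
    π (i + k * n) = π i + k * n := by
  induction k using Int.induction_on with
  | zero => simp
  | succ k ih =>
    have := h (i + k * n)
    rw [ih] at this
    rw [show i + ((k : ℤ) + 1) * n = i + k * n + n by ring, this]; ring
  | pred k ih =>
    have := h (i + (-(k : ℤ) - 1) * n)
    rw [show i + (-(k : ℤ) - 1) * n + n = i + -(k : ℤ) * n by ring, ih] at this
    linarith

theorem periodic_congr {n : ℕ} {g : ℤ → ℤ} (hg : ∀ i : ℤ, g (i + n) = g i) {i j : ℤ}
    (hij : (i : ZMod n) = (j : ZMod n)) : g i = g j := by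
  have key : ∀ k : ℤ, g (i + k * n) = g i := by
    intro k
    induction k using Int.induction_on with
    | zero => simp
    | succ k ih => rw [show i + ((k : ℤ) + 1) * n = i + k * n + n by ring, hg, ih]
    | pred k ih =>
      rw [← hg, show i + (-(k : ℤ) - 1) * n + n = i + -(k : ℤ) * n by ring, ih]
  rw [ZMod.intCast_eq_intCast_iff_dvd_sub] at hij
  obtain ⟨k, hk⟩ := hij
  rw [← key k, show i + k * n = j by linarith]

theorem sum_window {n : ℕ} [NeZero n] {g : ℤ → ℤ} (hg : ∀ i : ℤ, g (i + n) = g i) :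
    ∑ i ∈ Finset.Icc (1 : ℤ) n, g i = ∑ r : ZMod n, g (r.cast : ℤ) := by
  have hn : 0 < n := Nat.pos_of_ne_zero (NeZero.ne n)
  have hinj : Set.InjOn (fun i : ℤ => (i : ZMod n)) (Finset.Icc (1 : ℤ) n) := by
    intro a ha b hb hab
    simp only [Finset.coe_Icc, Set.mem_Icc] at ha hb
    have hab : (a : ZMod n) = (b : ZMod n) := hab
    rw [ZMod.intCast_eq_intCast_iff_dvd_sub] at hab
    have h0 := Int.eq_zero_of_abs_lt_dvd hab (by rw [abs_lt]; constructor <;> omega)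
    omega
  have himg : (Finset.Icc (1 : ℤ) n).image (fun i : ℤ => (i : ZMod n)) = Finset.univ := by
    apply Finset.eq_univ_of_card
    rw [Finset.card_image_of_injOn hinj, ZMod.card]
    simp
  rw [← himg, Finset.sum_image hinj]
  exact Finset.sum_congr rfl fun i _ => periodic_congr hg (by simp)

theorem residue_injective {n : ℕ} {π : Equiv.Perm ℤ} (h : ∀ i : ℤ, π (i + n) = π i + n) {i j : ℤ} :
    ((π i : ℤ) : ZMod n) = ((π j : ℤ) : ZMod n) ↔ (i : ZMod n) = (j : ZMod n) := by
  rw [ZMod.intCast_eq_intCast_iff_dvd_sub, ZMod.intCast_eq_intCast_iff_dvd_sub]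
  constructor
  · rintro ⟨k, hk⟩
    have : π j = π (i + k * n) := by rw [shift_mul h]; linarith
    have := π.injective this
    exact ⟨k, by rw [this]; ring⟩
  · rintro ⟨k, hk⟩
    have : j = i + k * n := by linarith
    exact ⟨k, by rw [this, shift_mul h]; ring⟩

theorem residue_bijective {n : ℕ} [NeZero n] {π : Equiv.Perm ℤ}
    (h : ∀ i : ℤ, π (i + n) = π i + n) :
    Function.Bijective (fun r : ZMod n => ((π (r.cast : ℤ) : ℤ) : ZMod n)) := by
  rw [← Finite.injective_iff_bijective]
  intro r s hrs
  have := (residue_injective h).1 hrs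
  simpa using this

theorem sum_residue {n : ℕ} [NeZero n] {g : ℤ → ℤ} (hg : ∀ i : ℤ, g (i + n) = g i)
    {π : Equiv.Perm ℤ} (h : ∀ i : ℤ, π (i + n) = π i + n) :
    ∑ i ∈ Finset.Icc (1 : ℤ) n, g (π i) = ∑ i ∈ Finset.Icc (1 : ℤ) n, g i := by
  rw [sum_window (g := fun i => g (π i)) (fun i => by simp only [h, hg]), sum_window hg]
  rw [← (residue_bijective h).sum_comp (fun r => g (r.cast : ℤ))]
  exact Finset.sum_congr rfl fun r _ => periodic_congr hg (by simp)

theorem inv_shift {n : ℕ} {π : Equiv.Perm ℤ} (h : ∀ i : ℤ, π (i + n) = π i + n) (i : ℤ) :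
    π⁻¹ (i + n) = π⁻¹ i + n := by
  apply π.injective
  rw [h]; simp

/-- The affine symmetric group: bijections `π : ℤ → ℤ` with `π (i + n) = π i + n` for all `i` and
`π 1 + ⋯ + π n = 1 + ⋯ + n`. -/
def AffPerm (n : ℕ) [NeZero n] : Subgroup (Equiv.Perm ℤ) where
  carrier := {π | (∀ i : ℤ, π (i + n) = π i + n) ∧
    ∑ i ∈ Finset.Icc (1 : ℤ) n, π i = ∑ i ∈ Finset.Icc (1 : ℤ) n, i}
  one_mem' := by simp
  mul_mem' := by
    rintro a b ⟨ha, ha'⟩ ⟨hb, hb'⟩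
    refine ⟨fun i => by simp only [Equiv.Perm.mul_apply, hb, ha], ?_⟩
    have := sum_residue (g := fun i => a i - i) (fun i => by simp only [ha]; ring) hb
    simp only [Finset.sum_sub_distrib] at this
    simp only [Equiv.Perm.mul_apply]
    linarith
  inv_mem' := by
    rintro a ⟨ha, ha'⟩
    refine ⟨inv_shift ha, ?_⟩
    have := sum_residue (g := fun i => a⁻¹ i - i) (fun i => by simp only [inv_shift ha]; ring) ha
    simp only [Finset.sum_sub_distrib, show ∀ i, a⁻¹ (a i) = i by simp] at this
    linarith

/-- The permutation of `ℤ/nℤ` induced by `π`. -/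
def residuePerm {n : ℕ} [NeZero n] (π : AffPerm n) : Equiv.Perm (ZMod n) :=
  Equiv.ofBijective (fun r : ZMod n => ((π.1 (r.cast : ℤ) : ℤ) : ZMod n)) (residue_bijective π.2.1)

theorem residuePerm_coe {n : ℕ} [NeZero n] (π : AffPerm n) (i : ℤ) :
    residuePerm π (i : ZMod n) = ((π.1 i : ℤ) : ZMod n) :=
  (residue_injective π.2.1).2 (by simp)

/-- The underlying map of the simple generator `s_i` (for `n ≥ 2`): interchange `i + kn` and
`i + 1 + kn` for all `k`, fix everything else. -/
def simpleFun (n : ℕ) (i j : ℤ) : ℤ :=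
  if (j : ZMod n) = (i : ZMod n) then j + 1
  else if (j : ZMod n) = ((i + 1 : ℤ) : ZMod n) then j - 1 else j

theorem cast_ne_succ {n : ℕ} (hn : 2 ≤ n) (i : ℤ) : ((i : ℤ) : ZMod n) ≠ ((i + 1 : ℤ) : ZMod n) := by
  have : Fact (1 < n) := ⟨hn⟩
  simp

theorem simpleFun_involutive {n : ℕ} (hn : 2 ≤ n) (i : ℤ) :
    Function.Involutive (simpleFun n i) := by
  intro j
  have hne := cast_ne_succ hn i
  unfold simpleFun
  by_cases h1 : (j : ZMod n) = (i : ZMod n)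
  · have : ((j + 1 : ℤ) : ZMod n) = ((i + 1 : ℤ) : ZMod n) := by push_cast; rw [h1]
    simp only [h1, if_true, this, hne.symm, if_false]; ring
  · by_cases h2 : (j : ZMod n) = ((i + 1 : ℤ) : ZMod n)
    · have : ((j - 1 : ℤ) : ZMod n) = (i : ZMod n) := by
        push_cast at h2 ⊢; rw [h2]; ring
      simp only [h2, if_true, this, hne.symm, if_false]; ring
    · simp only [h1, h2, if_false]

theorem simpleFun_shift (n : ℕ) (i j : ℤ) : simpleFun n i (j + n) = simpleFun n i j + n := by
  unfold simpleFun
  have : ((j + n : ℤ) : ZMod n) = (j : ZMod n) := by simp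
  rw [this]
  split_ifs <;> ring

theorem simpleFun_sum {n : ℕ} [NeZero n] (hn : 2 ≤ n) (i : ℤ) :
    ∑ j ∈ Finset.Icc (1 : ℤ) n, simpleFun n i j = ∑ j ∈ Finset.Icc (1 : ℤ) n, j := by
  have := sum_window (n := n) (g := fun j => simpleFun n i j - j)
    (fun j => by simp only [simpleFun_shift]; ring)
  rw [Finset.sum_eq_add (i : ZMod n) ((i + 1 : ℤ) : ZMod n) (cast_ne_succ hn i)] at this
  · simp only [Finset.sum_sub_distrib, simpleFun, ZMod.intCast_cast, ZMod.cast_id', id,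
      (cast_ne_succ hn i).symm, if_true, if_false] at this
    simp only [simpleFun]
    linarith
  · rintro r - ⟨h1, h2⟩
    simp only [simpleFun, ZMod.intCast_cast, ZMod.cast_id', id, h1, h2, if_false, sub_self]
  · simp
  · simp

/-- The simple generator `s_i`, the affine permutation interchanging `i` and `i + 1` and fixing
every `j ∉ {i, i + 1} + nℤ`. For `n = 1` there are no such elements and the group is trivial; we then
put `s_i = 1`. -/
def simple (n : ℕ) [NeZero n] (i : ℤ) : AffPerm n :=
  if hn : 2 ≤ n then
    ⟨(simpleFun_involutive hn i).toPerm, simpleFun_shift n i, simpleFun_sum hn i⟩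
  else 1

/-- The product `s_{i_1} s_{i_2} ⋯ s_{i_l}`. -/
def wordProd (n : ℕ) [NeZero n] (w : List ℤ) : AffPerm n := (w.map (simple n)).prod

/-- The length of `π`: the least number of factors in an expression of `π` through the `s_i`. -/
def len {n : ℕ} [NeZero n] (π : AffPerm n) : ℕ :=
  sInf {l | ∃ w : List ℤ, wordProd n w = π ∧ w.length = l}

/-- `w` is a reduced expression for `π`. -/
def IsReduced {n : ℕ} [NeZero n] (w : List ℤ) (π : AffPerm n) : Prop :=
  wordProd n w = π ∧ w.length = len π

/-- `π` is cyclically decreasing: it has a reduced expression `s_{i_1} ⋯ s_{i_l}` such that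
`s_{i_j + 1} ≠ s_{i_k}` for all `j < k`. -/
def IsCyclicallyDecreasing {n : ℕ} [NeZero n] (π : AffPerm n) : Prop :=
  ∃ w : List ℤ, IsReduced w π ∧ w.Pairwise fun a b => simple n (a + 1) ≠ simple n b

theorem simple_apply {n : ℕ} [NeZero n] (hn : 2 ≤ n) (i j : ℤ) :
    (simple n i).1 j = simpleFun n i j := by
  simp [simple, hn, Function.Involutive.toPerm]

theorem simple_mul_self {n : ℕ} [NeZero n] (i : ℤ) : simple n i * simple n i = 1 := by
  by_cases hn : 2 ≤ n
  · apply Subtype.ext; apply Equiv.ext; intro j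
    simp only [Subgroup.coe_mul, Equiv.Perm.mul_apply, simple_apply hn]
    exact simpleFun_involutive hn i j
  · simp [simple, hn]

/-- The deviation of `π` from the identity, used for an induction. -/
def dev {n : ℕ} [NeZero n] (π : AffPerm n) : ℤ := ∑ i ∈ Finset.Icc (1 : ℤ) n, (π.1 i - i) ^ 2

theorem eq_one_of_no_descent {n : ℕ} [NeZero n] (π : AffPerm n)
    (h : ∀ i : ℤ, π.1 i < π.1 (i + 1)) : π = 1 := by
  have hn : 0 < n := Nat.pos_of_ne_zero (NeZero.ne n)
  have hmono : StrictMono π.1 := strictMono_int_of_lt_succ h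
  have hstep : ∀ i : ℤ, π.1 (i + 1) = π.1 i + 1 := by
    intro i
    obtain ⟨j, hj⟩ := π.1.surjective (π.1 i + 1)
    have h1 : i < j := hmono.lt_iff_lt.1 (by omega)
    have h2 : π.1 (i + 1) ≤ π.1 j := hmono.monotone (by omega)
    have := h i
    omega
  have hall : ∀ i : ℤ, π.1 i = π.1 0 + i := by
    intro i
    induction i using Int.induction_on with
    | zero => simp
    | succ k ih => rw [hstep, ih]; ring
    | pred k ih => have := hstep (-(k : ℤ) - 1); rw [sub_add_cancel, ih] at this; linarith
  have hsum := π.2.2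
  rw [Finset.sum_congr rfl fun i _ => hall i, Finset.sum_add_distrib] at hsum
  have h0 : π.1 0 = 0 := by
    have : (n : ℤ) * π.1 0 = 0 := by simpa using hsum
    rcases mul_eq_zero.1 this with h | h
    · omega
    · exact h
  apply Subtype.ext; apply Equiv.ext; intro i
  rw [hall i, h0]; simp

theorem dev_mul_simple {n : ℕ} [NeZero n] (hn : 2 ≤ n) (π : AffPerm n) (i : ℤ) :
    dev (π * simple n i) = dev π + 2 * (π.1 (i + 1) - π.1 i) := by
  set g : ℤ → ℤ := fun j => (π.1 (simpleFun n i j) - j) ^ 2 - (π.1 j - j) ^ 2 with hg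
  have hper : ∀ j : ℤ, g (j + n) = g j := by
    intro j; simp only [hg, simpleFun_shift, π.2.1]; ring
  have h1 : dev (π * simple n i) - dev π = ∑ j ∈ Finset.Icc (1 : ℤ) n, g j := by
    simp only [dev, hg, Finset.sum_sub_distrib, Subgroup.coe_mul, Equiv.Perm.mul_apply,
      simple_apply hn]
  rw [sum_window hper,
    Finset.sum_eq_add (i : ZMod n) ((i + 1 : ℤ) : ZMod n) (cast_ne_succ hn i)] at h1
  · rw [periodic_congr hper (i := ((i : ZMod n).cast : ℤ)) (j := i) (by simp),
      periodic_congr hper (i := (((i + 1 : ℤ) : ZMod n).cast : ℤ)) (j := i + 1) (by simp)] at h1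
    simp only [hg, simpleFun, (cast_ne_succ hn i).symm, if_true, if_false, add_sub_cancel_right] at h1
    linarith
  · rintro r - ⟨h1, h2⟩
    have : simpleFun n i (r.cast : ℤ) = r.cast := by
      simp only [simpleFun, ZMod.intCast_cast, ZMod.cast_id', id, h1, h2, if_false]
    simp only [hg, this, sub_self]
  · simp
  · simp

theorem exists_word {n : ℕ} [NeZero n] (π : AffPerm n) : ∃ w : List ℤ, wordProd n w = π := by
  have hdev : ∀ σ : AffPerm n, 0 ≤ dev σ := fun σ => Finset.sum_nonneg fun i _ => sq_nonneg _
  induction hk : (dev π).toNat using Nat.strong_induction_on generalizing π with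
  | _ k ih =>
    by_cases h : ∀ i : ℤ, π.1 i < π.1 (i + 1)
    · exact ⟨[], by rw [eq_one_of_no_descent π h]; rfl⟩
    · push Not at h
      obtain ⟨i, hi⟩ := h
      have hne : π.1 (i + 1) ≠ π.1 i := fun h => by have := π.1.injective h; omega
      have hn : 2 ≤ n := by
        by_contra hlt
        have h1 : n = 1 := by have := NeZero.ne n; omega
        have := π.2.1 i
        simp only [h1, Nat.cast_one] at this
        omega
      have hd := dev_mul_simple hn π i
      obtain ⟨w, hw⟩ := ih _ (by have := hdev π; have := hdev (π * simple n i); omega)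
        (π * simple n i) rfl
      refine ⟨w ++ [i], ?_⟩
      have : wordProd n (w ++ [i]) = wordProd n w * simple n i := by simp [wordProd]
      rw [this, hw, mul_assoc, simple_mul_self, mul_one]

theorem exists_isReduced {n : ℕ} [NeZero n] (π : AffPerm n) : ∃ w : List ℤ, IsReduced w π := by
  obtain ⟨w, hw⟩ := exists_word π
  exact Nat.sInf_mem (s := {l | ∃ w : List ℤ, wordProd n w = π ∧ w.length = l}) ⟨_, w, hw, rfl⟩

theorem simple_range_finite (n : ℕ) [NeZero n] : (Set.range (simple n)).Finite := by
  have : Set.range (simple n) ⊆ Set.range (fun r : ZMod n => simple n (r.cast : ℤ)) := by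
    rintro _ ⟨i, rfl⟩
    refine ⟨(i : ZMod n), ?_⟩
    simp only [simple]
    split_ifs with hn
    · apply Subtype.ext; apply Equiv.ext; intro j
      simp [Function.Involutive.toPerm, simpleFun]
    · rfl
  exact (Set.finite_range _).subset this

theorem finite_len_le (n : ℕ) [NeZero n] (L : ℕ) : {π : AffPerm n | len π ≤ L}.Finite := by
  have key : ∀ l : ℕ, {π : AffPerm n | ∃ w : List ℤ, wordProd n w = π ∧ w.length = l}.Finite := by
    intro l
    induction l with
    | zero =>
      refine (Set.finite_singleton (1 : AffPerm n)).subset ?_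
      rintro π ⟨w, rfl, hw⟩
      rw [List.length_eq_zero_iff] at hw
      simp [hw, wordProd]
    | succ l ih =>
      refine ((simple_range_finite n).image2 (· * ·) ih).subset ?_
      rintro π ⟨w, rfl, hw⟩
      match w, hw with
      | a :: w, hw =>
        exact ⟨simple n a, ⟨a, rfl⟩, wordProd n w, ⟨w, rfl, by simpa using hw⟩, by simp [wordProd]⟩
  refine ((Set.finite_Iic L).biUnion fun l _ => key l).subset ?_
  intro π hπ
  obtain ⟨w, hw, hl⟩ := exists_isReduced π
  simp only [Set.mem_iUnion]
  exact ⟨len π, hπ, w, hw, hl⟩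


theorem len_wordProd_le {n : ℕ} [NeZero n] (w : List ℤ) : len (wordProd n w) ≤ w.length :=
  Nat.sInf_le ⟨w, rfl, rfl⟩

theorem wordProd_append {n : ℕ} [NeZero n] (v w : List ℤ) :
    wordProd n (v ++ w) = wordProd n v * wordProd n w := by simp [wordProd]

theorem len_one {n : ℕ} [NeZero n] : len (1 : AffPerm n) = 0 := by
  simpa [wordProd] using len_wordProd_le (n := n) []

theorem eq_one_of_len_eq_zero {n : ℕ} [NeZero n] {π : AffPerm n} (h : len π = 0) : π = 1 := by
  obtain ⟨w, rfl, hl⟩ := exists_isReduced π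
  rw [h, List.length_eq_zero_iff] at hl
  simp [hl, wordProd]

/-! ### The Demazure product -/

/-- Right multiplication by a generator in the Demazure product: `π ∘ s_i` is `π s_i` if that is
longer than `π`, and `π` otherwise. -/
def demazureStep {n : ℕ} [NeZero n] (π : AffPerm n) (i : ℤ) : AffPerm n :=
  if len π < len (π * simple n i) then π * simple n i else π

/-- The Demazure product `u ∘ v = (⋯((u ∘ s_{i_1}) ∘ s_{i_2}) ⋯) ∘ s_{i_l}`, where
`v = s_{i_1} ⋯ s_{i_l}` is a reduced expression. -/
def demazure {n : ℕ} [NeZero n] (u v : AffPerm n) : AffPerm n :=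
  (Classical.choose (exists_isReduced v)).foldl demazureStep u

/-- The properties which characterize the Demazure product: it is associative, `s_i ∘ s_i = s_i`,
and `u ∘ v = u v` whenever `ℓ(u v) = ℓ(u) + ℓ(v)`. -/
structure IsDemazureProduct {n : ℕ} [NeZero n] (op : AffPerm n → AffPerm n → AffPerm n) :
    Prop where
  assoc : ∀ u v w, op (op u v) w = op u (op v w)
  idem : ∀ i, op (simple n i) (simple n i) = simple n i
  mul : ∀ u v, len (u * v) = len u + len v → op u v = u * v

theorem sign_wordProd {n : ℕ} [NeZero n] (hn : 2 ≤ n) (w : List ℤ) :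
    Equiv.Perm.sign (residuePerm (wordProd n w)) = (-1) ^ w.length := by
  have hmul : ∀ a b : AffPerm n, residuePerm (a * b) = residuePerm a * residuePerm b := by
    intro a b
    apply Equiv.ext; intro r
    obtain ⟨i, rfl⟩ := ZMod.intCast_surjective r
    simp only [Equiv.Perm.mul_apply, residuePerm_coe, Subgroup.coe_mul]
  induction w with
  | nil =>
    have h1 : residuePerm (wordProd n []) = 1 := by
      apply Equiv.ext; intro r
      obtain ⟨i, rfl⟩ := ZMod.intCast_surjective r
      simp [residuePerm_coe, wordProd]
    rw [h1]; simp
  | cons a w ih =>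
    have hsw : residuePerm (simple n a) = Equiv.swap (a : ZMod n) ((a + 1 : ℤ) : ZMod n) := by
      apply Equiv.ext; intro r
      obtain ⟨i, rfl⟩ := ZMod.intCast_surjective r
      rw [residuePerm_coe, simple_apply hn, simpleFun]
      split_ifs with h1 h2
      · rw [h1, Equiv.swap_apply_left]; push_cast; rw [h1]
      · rw [h2, Equiv.swap_apply_right]; push_cast at h2 ⊢; rw [h2]; ring
      · rw [Equiv.swap_apply_of_ne_of_ne h1 h2]
    have : wordProd n (a :: w) = simple n a * wordProd n w := by simp [wordProd]
    rw [this, hmul, hsw, map_mul, ih, Equiv.Perm.sign_swap (cast_ne_succ hn a), List.length_cons,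
      pow_succ, mul_comm]

theorem len_mul_le {n : ℕ} [NeZero n] (u v : AffPerm n) : len (u * v) ≤ len u + len v := by
  obtain ⟨a, rfl, ha⟩ := exists_isReduced u
  obtain ⟨b, rfl, hb⟩ := exists_isReduced v
  rw [← wordProd_append, ← ha, ← hb, ← List.length_append]
  exact len_wordProd_le _

theorem len_mul_simple_ne {n : ℕ} [NeZero n] (hn : 2 ≤ n) (u : AffPerm n) (i : ℤ) :
    len (u * simple n i) ≠ len u := by
  intro h
  obtain ⟨a, ha, hl⟩ := exists_isReduced u
  obtain ⟨b, hb, hl'⟩ := exists_isReduced (u * simple n i)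
  have h1 : wordProd n b = wordProd n (a ++ [i]) := by
    rw [hb, wordProd_append, ha]; simp [wordProd]
  have h2 := sign_wordProd hn b
  rw [h1, sign_wordProd hn, List.length_append, hl, hl', h, List.length_singleton, pow_succ] at h2
  rcases neg_one_pow_eq_or ℤˣ (len u) with h3 | h3 <;> rw [h3] at h2 <;> revert h2 <;> decide

/-- `demazure` is the Demazure product: no other operation has the characteristic properties. -/
theorem IsDemazureProduct.eq_demazure {n : ℕ} [NeZero n] {op : AffPerm n → AffPerm n → AffPerm n}
    (h : IsDemazureProduct op) : op = demazure := by
  have hone : ∀ u, op u 1 = u := fun u => by rw [h.mul u 1 (by simp [len_one]), mul_one]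
  have hstep : ∀ u i, op u (simple n i) = demazureStep u i := by
    intro u i
    by_cases hn : 2 ≤ n
    · have hs : len (simple n i) = 1 := by
        have h1 := len_mul_simple_ne hn 1 i
        have h2 := len_wordProd_le (n := n) [i]
        simp only [one_mul, len_one] at h1
        simp [wordProd] at h2
        omega
      have hle := len_mul_le u (simple n i)
      have hne := len_mul_simple_ne hn u i
      have hge := len_mul_le (u * simple n i) (simple n i)
      rw [mul_assoc, simple_mul_self, mul_one] at hge
      unfold demazureStep
      split_ifs with hlt
      · exact h.mul _ _ (by omega)
      · have h1 : op (u * simple n i) (simple n i) = u := by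
          rw [h.mul _ _ (by rw [mul_assoc, simple_mul_self, mul_one]; omega), mul_assoc,
            simple_mul_self, mul_one]
        rw [← h1, h.assoc, h.idem]
    · have hs : simple n i = 1 := by simp [simple, hn]
      simp [hs, hone, demazureStep]
  have hword : ∀ w : List ℤ, w.length = len (wordProd n w) →
      ∀ u, op u (wordProd n w) = w.foldl demazureStep u := by
    intro w
    induction w using List.reverseRecOn with
    | nil => intro _ u; simpa [wordProd] using hone u
    | append_singleton w i ih =>
      intro hw u
      have hi : wordProd n [i] = simple n i := by simp [wordProd]
      have h1 := len_mul_le (wordProd n w) (wordProd n [i])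
      have h2 := len_wordProd_le (n := n) w
      have h3 := len_wordProd_le (n := n) [i]
      rw [← wordProd_append, ← hw] at h1
      simp only [List.length_append, List.length_singleton] at h1 h3 hw
      have h4 : wordProd n (w ++ [i]) = op (wordProd n w) (wordProd n [i]) := by
        rw [h.mul _ _ (by rw [← wordProd_append, ← hw]; omega), wordProd_append]
      rw [h4, ← h.assoc, ih (by omega), hi, hstep, List.foldl_append]
      rfl
  funext u v
  obtain ⟨h1, h2⟩ := Classical.choose_spec (exists_isReduced v)
  have := hword _ (by rw [h1]; exact h2) u
  rw [h1] at this
  exact this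


/-! ### Quasi-symmetric functions -/

/-- For a monomial `x^d` this is the sequence of its nonzero exponents, read in increasing order of
the variables: `x_{i_1}^{a_1} ⋯ x_{i_k}^{a_k}` with `i_1 < ⋯ < i_k` and all `a_j > 0` gives
`[a_1, …, a_k]`. -/
def compress (d : ℕ →₀ ℕ) : List ℕ+ := d.support.sort.map fun i => (d i).toPNat'

/-- The space of quasi-symmetric functions over `ℚ` in the variables `x_0, x_1, x_2, …`: the power
series of bounded degree in which `x_{i_1}^{a_1} ⋯ x_{i_k}^{a_k}` and
`x_{j_1}^{a_1} ⋯ x_{j_k}^{a_k}` have the same coefficient whenever `i_1 < ⋯ < i_k`,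
`j_1 < ⋯ < j_k` and all `a_t > 0`. -/
def QSym : Submodule ℚ (MvPowerSeries ℕ ℚ) where
  carrier := {f | (∃ D : ℕ, ∀ d : ℕ →₀ ℕ, D < d.degree → MvPowerSeries.coeff d f = 0) ∧
    ∀ d e : ℕ →₀ ℕ, compress d = compress e → MvPowerSeries.coeff d f = MvPowerSeries.coeff e f}
  zero_mem' := by simp
  add_mem' := by
    rintro f g ⟨⟨D, hD⟩, hf⟩ ⟨⟨E, hE⟩, hg⟩
    refine ⟨⟨max D E, fun d hd => ?_⟩, fun d e h => ?_⟩
    · rw [map_add, hD d (by omega), hE d (by omega), add_zero]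
    · rw [map_add, map_add, hf d e h, hg d e h]
  smul_mem' := by
    rintro c f ⟨⟨D, hD⟩, hf⟩
    refine ⟨⟨D, fun d hd => ?_⟩, fun d e h => ?_⟩
    · rw [map_smul, hD d hd, smul_zero]
    · rw [map_smul, map_smul, hf d e h]

theorem compress_map_coe (d : ℕ →₀ ℕ) :
    (compress d).map PNat.val = d.support.sort.map d := by
  rw [compress, List.map_map]
  refine List.map_congr_left fun i hi => ?_
  have : d i ≠ 0 := by simpa using hi
  simp [Nat.pos_of_ne_zero this]

theorem compress_sum (d : ℕ →₀ ℕ) : ((compress d).map PNat.val).sum = d.degree := by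
  rw [compress_map_coe, Finsupp.degree_apply, Finset.sum_eq_multiset_sum, ← Finset.sort_eq d.support (· ≤ ·)]
  rw [Multiset.map_coe, Multiset.sum_coe]

/-- The exponent of the monomial `x_0^{a_0} ⋯ x_{k-1}^{a_{k-1}}`. -/
def stdExp (α : List ℕ+) : ℕ →₀ ℕ := (α.map PNat.val).toFinsupp

theorem compress_stdExp (α : List ℕ+) : compress (stdExp α) = α := by
  have hs : (stdExp α).support = Finset.range α.length := by
    ext i
    rw [Finsupp.mem_support_iff, stdExp, List.toFinsupp_apply, Finset.mem_range]
    by_cases h : i < α.length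
    · simp [h]
    · simp [h]
  rw [compress, hs, Finset.sort_range]
  apply List.ext_getElem
  · simp
  · intro i h1 h2
    simp [stdExp, h2]

theorem finite_sum_le (D : ℕ) : {α : List ℕ+ | (α.map PNat.val).sum ≤ D}.Finite := by
  have : ∀ m : ℕ, {α : List ℕ+ | (α.map PNat.val).sum = m}.Finite := by
    intro m
    refine Set.Finite.of_injOn (f := fun α : List ℕ+ => α.map PNat.val)
      (t := Set.range (fun c : Composition m => c.blocks)) ?_ ?_ (Set.finite_range _)
    · intro α hα
      exact ⟨⟨α.map PNat.val, by
        intro i hi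
        obtain ⟨a, _, rfl⟩ := List.mem_map.1 hi
        exact a.pos, hα⟩, rfl⟩
    · intro α _ β _ h
      exact List.map_injective_iff.2 PNat.coe_injective h
  refine ((Set.finite_Iic D).biUnion fun m _ => this m).subset ?_
  intro α hα
  simp only [Set.mem_iUnion]
  exact ⟨_, hα, rfl⟩

/-- A quasi-symmetric function is determined by a finitely supported family of coefficients, one for
each finite sequence of positive integers. -/
def qsymEquiv : QSym ≃ₗ[ℚ] (List ℕ+ →₀ ℚ) where
  toFun f := Finsupp.ofSupportFinite (fun α => MvPowerSeries.coeff (stdExp α) f.1) (by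
    obtain ⟨D, hD⟩ := f.2.1
    refine (finite_sum_le D).subset fun α hα => ?_
    by_contra hlt
    refine hα (hD _ ?_)
    rw [← compress_sum, compress_stdExp]
    simpa using hlt)
  map_add' f g := by ext α; simp [Finsupp.ofSupportFinite_coe]
  map_smul' c f := by ext α; simp [Finsupp.ofSupportFinite_coe]
  invFun c := ⟨fun d => c (compress d), by
    refine ⟨⟨c.support.sup fun α => (α.map PNat.val).sum, fun d hd => ?_⟩, fun d e h => ?_⟩
    · change c (compress d) = 0
      by_contra hne
      have := Finset.le_sup (f := fun α : List ℕ+ => (α.map PNat.val).sum)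
        (Finsupp.mem_support_iff.2 hne)
      simp only [compress_sum] at this
      omega
    · change c (compress d) = c (compress e)
      rw [h]⟩
  left_inv f := by
    apply Subtype.ext
    ext d
    exact f.2.2 _ _ (compress_stdExp _)
  right_inv c := by
    ext α
    change c (compress (stdExp α)) = c α
    rw [compress_stdExp]

/-- The basis of monomial quasi-symmetric functions `M_α`, indexed by compositions `α`. -/
def qsymBasis : Module.Basis (List ℕ+) ℚ QSym := Module.Basis.ofRepr qsymEquiv

/-- `M_{(a_1, …, a_k)}` is the sum of all monomials `x_{i_1}^{a_1} ⋯ x_{i_k}^{a_k}` with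
`i_1 < ⋯ < i_k`. -/
theorem coeff_qsymBasis (α : List ℕ+) (d : ℕ →₀ ℕ) :
    MvPowerSeries.coeff d (qsymBasis α : MvPowerSeries ℕ ℚ) = if compress d = α then 1 else 0 := by
  change (Finsupp.single α (1 : ℚ)) (compress d) = _
  rw [Finsupp.single_apply]
  simp only [eq_comm]

/-- The coalgebra structure of the quasi-symmetric functions: `Δ(M_α) = ∑ M_β ⊗ M_γ` over all pairs
`(β, γ)` whose concatenation is `α`, and the counit is `1` on `M_∅` and `0` on the other `M_α`. -/
instance : CoalgebraStruct ℚ QSym where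
  comul := qsymBasis.constr ℚ fun α =>
    ∑ i ∈ Finset.range (α.length + 1), qsymBasis (α.take i) ⊗ₜ[ℚ] qsymBasis (α.drop i)
  counit := qsymBasis.constr ℚ fun α => if α = [] then 1 else 0

theorem comul_qsymBasis (α : List ℕ+) : CoalgebraStruct.comul (R := ℚ) (qsymBasis α) =
    ∑ i ∈ Finset.range (α.length + 1), qsymBasis (α.take i) ⊗ₜ[ℚ] qsymBasis (α.drop i) :=
  qsymBasis.constr_basis ℚ _ _

theorem counit_qsymBasis (α : List ℕ+) :
    CoalgebraStruct.counit (R := ℚ) (qsymBasis α) = if α = [] then 1 else 0 :=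
  qsymBasis.constr_basis ℚ _ _

instance : Coalgebra ℚ QSym where
  coassoc := by
    refine qsymBasis.ext fun α => ?_
    simp only [LinearMap.comp_apply, comul_qsymBasis, map_sum, LinearMap.rTensor_tmul,
      LinearMap.lTensor_tmul, TensorProduct.sum_tmul, TensorProduct.tmul_sum,
      LinearEquiv.coe_coe, TensorProduct.assoc_tmul]
    rw [Finset.sum_sigma', Finset.sum_sigma']
    refine Finset.sum_nbij' (fun p => ⟨p.2, p.1 - p.2⟩) (fun p => ⟨p.1 + p.2, p.1⟩) ?_ ?_ ?_ ?_ ?_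
    · rintro ⟨i, j⟩ h
      simp at h ⊢
      omega
    · rintro ⟨i, j⟩ h
      simp at h ⊢
      omega
    · rintro ⟨i, j⟩ h
      simp at h ⊢
      omega
    · rintro ⟨i, j⟩ h
      simp
    · rintro ⟨i, j⟩ h
      simp only [Finset.mem_sigma, Finset.mem_range, List.length_take] at h
      have h1 : j ≤ i := by omega
      simp only [List.take_take, List.drop_take, List.drop_drop, min_eq_left h1]
      rw [show j + (i - j) = i by omega]
  rTensor_counit_comp_comul := by
    refine qsymBasis.ext fun α => ?_
    simp only [LinearMap.comp_apply, comul_qsymBasis, map_sum, LinearMap.rTensor_tmul,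
      counit_qsymBasis]
    rw [Finset.sum_eq_single 0]
    · simp
    · intro i hi h0
      have : α.take i ≠ [] := by
        intro h
        rw [List.take_eq_nil_iff] at h
        rcases h with h | h
        · exact h0 h
        · simp [h] at hi; exact h0 hi
      simp [this]
    · simp
  lTensor_counit_comp_comul := by
    refine qsymBasis.ext fun α => ?_
    simp only [LinearMap.comp_apply, comul_qsymBasis, map_sum, LinearMap.lTensor_tmul,
      counit_qsymBasis]
    rw [Finset.sum_eq_single α.length]
    · simp
    · intro i hi h0
      have : α.drop i ≠ [] := by
        intro h
        rw [List.drop_eq_nil_iff] at h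
        simp at hi; omega
      simp [this]
    · simp

/-- The homogeneous quasi-symmetric functions of degree `k`. -/
def qsymDegree (k : ℕ) : Submodule ℚ QSym where
  carrier := {f | ∀ d : ℕ →₀ ℕ, MvPowerSeries.coeff d (f : MvPowerSeries ℕ ℚ) ≠ 0 → d.degree = k}
  zero_mem' := by simp
  add_mem' := by
    intro f g hf hg d hd
    by_cases h : MvPowerSeries.coeff d (f : MvPowerSeries ℕ ℚ) = 0
    · exact hg d fun h' => hd (by rw [Submodule.coe_add, map_add, h, h', add_zero])
    · exact hf d h
  smul_mem' := by
    intro c f hf d hd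
    exact hf d fun h => hd (by rw [Submodule.coe_smul, map_smul, h, smul_zero])

/-! ### Graded comodules -/

/-- `ρ : M → M ⊗ C` makes `M`, graded by the submodules `ℳ k`, a graded right comodule of the
coalgebra `C`, graded by the submodules `𝒞 k`. -/
structure IsGradedRightComodule {R C M : Type*} [CommRing R] [AddCommGroup C] [Module R C]
    [Coalgebra R C] [AddCommGroup M] [Module R M] (𝒞 : ℕ → Submodule R C) (ℳ : ℕ → Submodule R M)
    (ρ : M →ₗ[R] M ⊗[R] C) : Prop where
  isInternal : DirectSum.IsInternal ℳ
  coassoc : (TensorProduct.assoc R M C C).toLinearMap ∘ₗ ρ.rTensor C ∘ₗ ρ =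
    (CoalgebraStruct.comul (R := R) (A := C)).lTensor M ∘ₗ ρ
  counit : (CoalgebraStruct.counit (R := R) (A := C)).lTensor M ∘ₗ ρ =
    (TensorProduct.mk R M R).flip 1
  graded : ∀ k, ∀ m ∈ ℳ k, ρ m ∈ ⨆ p ∈ Finset.HasAntidiagonal.antidiagonal k,
    LinearMap.range (TensorProduct.map (ℳ p.1).subtype (𝒞 p.2).subtype)

/-- `φ` is a morphism of graded right comodules from `(M, ρ)` to `(N, σ)`. -/
structure IsGradedComoduleHom {R C M N : Type*} [CommRing R] [AddCommGroup C] [Module R C]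
    [AddCommGroup M] [Module R M] [AddCommGroup N] [Module R N]
    (ℳ : ℕ → Submodule R M) (ρ : M →ₗ[R] M ⊗[R] C)
    (𝒩 : ℕ → Submodule R N) (σ : N →ₗ[R] N ⊗[R] C) (φ : M →ₗ[R] N) : Prop where
  comm : φ.rTensor C ∘ₗ ρ = σ ∘ₗ φ
  graded : ∀ k, ∀ m ∈ ℳ k, φ m ∈ 𝒩 k

/-! ### Affine Stanley symmetric functions -/

/-- `f 0, f 1, f 2, …` is a factorization `π = π^1 π^2 ⋯` into cyclically decreasing elements (all
but finitely many of them trivial) with `ℓ(π) = ℓ(π^1) + ℓ(π^2) + ⋯`. -/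
structure IsFactorization {n : ℕ} [NeZero n] (π : AffPerm n) (f : ℕ → AffPerm n) : Prop where
  cyclicallyDecreasing : ∀ i, IsCyclicallyDecreasing (f i)
  eq_prod : ∃ N : ℕ, (∀ i, N ≤ i → f i = 1) ∧ ((List.range N).map f).prod = π ∧
    ∑ i ∈ Finset.range N, len (f i) = len π

theorem finite_factorization {n : ℕ} [NeZero n] (π : AffPerm n) (d : ℕ →₀ ℕ) :
    {f : ℕ → AffPerm n | IsFactorization π f ∧ ∀ i, len (f i) = d i}.Finite := by
  have hfin : (Set.univ.pi fun i : d.support => {σ : AffPerm n | len σ ≤ d i}).Finite :=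
    Set.Finite.pi fun i => finite_len_le n _
  refine Set.Finite.of_injOn (f := fun (f : ℕ → AffPerm n) (i : d.support) => f i) ?_ ?_ hfin
  · intro f hf i _
    exact (hf.2 i).le
  · intro f hf g hg h
    funext i
    by_cases hi : i ∈ d.support
    · exact congrFun h ⟨i, hi⟩
    · have h0 : d i = 0 := by simpa using hi
      rw [eq_one_of_len_eq_zero ((hf.2 i).trans h0), eq_one_of_len_eq_zero ((hg.2 i).trans h0)]

/-- The affine Stanley symmetric function as a power series: the coefficient of `x^d` is the number
of factorizations `π = π^1 π^2 ⋯` as above with `ℓ(π^i)` equal to the exponent of the `i`th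
variable. -/
def stanleySeries {n : ℕ} [NeZero n] (π : AffPerm n) : MvPowerSeries ℕ ℚ := fun d =>
  ({f : ℕ → AffPerm n | IsFactorization π f ∧ ∀ i, len (f i) = d i}.ncard : ℚ)

theorem coeff_stanleySeries {n : ℕ} [NeZero n] (π : AffPerm n) (d : ℕ →₀ ℕ) :
    MvPowerSeries.coeff d (stanleySeries π) =
      ({f : ℕ → AffPerm n | IsFactorization π f ∧ ∀ i, len (f i) = d i}.ncard : ℚ) := rfl

theorem factorization_iff {n : ℕ} [NeZero n] {π : AffPerm n} {f : ℕ → AffPerm n} {d : ℕ →₀ ℕ}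
    (hd : ∀ i, len (f i) = d i) : IsFactorization π f ↔ (∀ i ∈ d.support, IsCyclicallyDecreasing (f i))
      ∧ (d.support.sort.map f).prod = π ∧ d.degree = len π := by
  have hone : ∀ i, i ∉ d.support → f i = 1 := fun i hi =>
    eq_one_of_len_eq_zero ((hd i).trans (by simpa using hi))
  have hcd1 : IsCyclicallyDecreasing (1 : AffPerm n) := ⟨[], ⟨rfl, by rw [len_one]; rfl⟩, by simp⟩
  have key : ∀ N : ℕ, (∀ i, N ≤ i → f i = 1) → d.support ⊆ Finset.range N ∧
      ((List.range N).map f).prod = (d.support.sort.map f).prod ∧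
      ∑ i ∈ Finset.range N, len (f i) = d.degree := by
    intro N hN
    have hsub : d.support ⊆ Finset.range N := by
      intro i hi
      rw [Finset.mem_range]
      by_contra hlt
      rw [Finsupp.mem_support_iff, ← hd, hN i (by omega), len_one] at hi
      exact hi rfl
    refine ⟨hsub, ?_, ?_⟩
    · have hfilter : (List.range N).filter (· ∈ d.support) = d.support.sort := by
        refine List.Perm.eq_of_pairwise' (r := (· ≤ ·)) ?_ (Finset.pairwise_sort _ _) ?_
        · exact (List.pairwise_le_range (n := N)).filter _
        · rw [List.perm_ext_iff_of_nodup (List.nodup_range.filter _) (Finset.sort_nodup _ _)]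
          intro i
          simp only [List.mem_filter, Finset.mem_sort, List.mem_range, decide_eq_true_eq]
          exact ⟨fun h => h.2, fun h => ⟨by simpa using hsub h, h⟩⟩
      rw [← hfilter]
      generalize List.range N = l
      induction l with
      | nil => simp
      | cons a l ih =>
        by_cases ha : a ∈ d.support
        · rw [List.filter_cons_of_pos (by simpa using ha)]
          simp only [List.map_cons, List.prod_cons, ih]
        · rw [List.filter_cons_of_neg (by simpa using ha)]
          simp only [List.map_cons, List.prod_cons, ih, hone a ha, one_mul]
    · rw [Finset.sum_congr rfl fun i _ => hd i, Finsupp.degree_apply]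
      refine (Finset.sum_subset hsub fun i _ hi => by simpa using hi).symm
  constructor
  · rintro ⟨h1, N, h2, h3, h4⟩
    obtain ⟨-, h5, h6⟩ := key N h2
    exact ⟨fun i _ => h1 i, by rw [← h5, h3], by rw [← h6, h4]⟩
  · rintro ⟨h1, h2, h3⟩
    have hN : ∀ i, d.support.sup id + 1 ≤ i → f i = 1 := fun i hi => hone i fun hmem => by
      have := Finset.le_sup (f := id) hmem
      simp only [id] at this
      omega
    obtain ⟨-, h5, h6⟩ := key _ hN
    refine ⟨fun i => ?_, _, hN, by rw [h5, h2], by rw [h6, h3]⟩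
    by_cases hi : i ∈ d.support
    · exact h1 i hi
    · rw [hone i hi]; exact hcd1

theorem card_factorization {n : ℕ} [NeZero n] (π : AffPerm n) (d : ℕ →₀ ℕ) :
    {f : ℕ → AffPerm n | IsFactorization π f ∧ ∀ i, len (f i) = d i}.ncard =
    {l : List (AffPerm n) | l.map len = (compress d).map PNat.val ∧
      (∀ σ ∈ l, IsCyclicallyDecreasing σ) ∧ l.prod = π ∧
      ((compress d).map PNat.val).sum = len π}.ncard := by
  refine Set.ncard_congr (fun f _ => d.support.sort.map f) ?_ ?_ ?_
  · rintro f ⟨hf, hd⟩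
    obtain ⟨h1, h2, h3⟩ := (factorization_iff hd).1 hf
    refine ⟨?_, ?_, h2, by rw [compress_sum, h3]⟩
    · rw [compress_map_coe, List.map_map]
      exact List.map_congr_left fun i _ => hd i
    · intro σ hσ
      obtain ⟨i, hi, rfl⟩ := List.mem_map.1 hσ
      exact h1 i (by simpa using hi)
  · rintro f g ⟨-, hf⟩ ⟨-, hg⟩ h
    funext i
    by_cases hi : i ∈ d.support
    · exact List.map_inj_left.1 h i (by simpa using hi)
    · have h0 : d i = 0 := by simpa using hi
      rw [eq_one_of_len_eq_zero ((hf i).trans h0), eq_one_of_len_eq_zero ((hg i).trans h0)]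
  · rintro l ⟨h1, h2, h3, h4⟩
    rw [compress_map_coe] at h1
    have hlen : l.length = d.support.sort.length := by simpa using congrArg List.length h1
    have hnd := Finset.sort_nodup d.support (· ≤ ·)
    set f : ℕ → AffPerm n := fun i =>
      if i ∈ d.support then l.getD (d.support.sort.idxOf i) 1 else 1 with hf
    have hmap : d.support.sort.map f = l := by
      apply List.ext_getElem
      · simp [hlen]
      · intro i hi1 hi2
        have hi3 : i < d.support.sort.length := by omega
        have hmem : d.support.sort[i] ∈ d.support :=
          (Finset.mem_sort _).1 (List.getElem_mem hi3)
        rw [List.getElem_map]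
        simp only [hf]
        rw [if_pos hmem, hnd.idxOf_getElem i hi3, List.getD_eq_getElem _ _ hi2]
    have hd : ∀ i, len (f i) = d i := by
      intro i
      by_cases hi : i ∈ d.support
      · rw [← hmap, List.map_map] at h1
        exact List.map_inj_left.1 h1 i (by simpa using hi)
      · have h0 : d i = 0 := by simpa using hi
        simp only [hf, hi, if_false, h0, len_one]
    refine ⟨f, ⟨(factorization_iff hd).2 ⟨?_, by rw [hmap, h3], by rw [← compress_sum, h4]⟩, hd⟩,
      hmap⟩
    intro i hi
    refine h2 _ ?_
    rw [← hmap]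
    exact List.mem_map.2 ⟨i, by simpa using hi, rfl⟩

/-- The affine Stanley symmetric function `F_π`, as an element of the space of quasi-symmetric
functions. -/
def stanley {n : ℕ} [NeZero n] (π : AffPerm n) : QSym := ⟨stanleySeries π, by
  refine ⟨⟨len π, fun d hd => ?_⟩, fun d e h => ?_⟩
  · rw [coeff_stanleySeries]
    have : {f : ℕ → AffPerm n | IsFactorization π f ∧ ∀ i, len (f i) = d i} = ∅ := by
      refine Set.eq_empty_of_forall_notMem fun f hf => ?_
      have := ((factorization_iff hf.2).1 hf.1).2.2
      omega
    rw [this, Set.ncard_empty, Nat.cast_zero]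
  · rw [coeff_stanleySeries, coeff_stanleySeries, card_factorization, card_factorization, h]⟩

/-- The linear map `ℚ S̃_n → QSym` with `π ↦ F_π`. -/
def stanleyMap (n : ℕ) [NeZero n] : (AffPerm n →₀ ℚ) →ₗ[ℚ] QSym :=
  Finsupp.linearCombination ℚ stanley

/-! ### Affine involutions -/

/-- The set of affine involutions `z = z⁻¹`. -/
abbrev AffInvol (n : ℕ) [NeZero n] : Type := {z : AffPerm n // z = z⁻¹}

/-- The identity, as an affine involution. -/
def AffInvol.one (n : ℕ) [NeZero n] : AffInvol n := ⟨1, inv_one.symm⟩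

/-- The Hecke atoms of `z`: the elements `π` with `π⁻¹ ∘ π = z`. -/
def heckeAtoms {n : ℕ} [NeZero n] (z : AffInvol n) : Set (AffPerm n) :=
  {π | demazure π⁻¹ π = z.1}

/-- The atoms of `z`: the Hecke atoms of minimal length. -/
def atoms {n : ℕ} [NeZero n] (z : AffInvol n) : Set (AffPerm n) :=
  {π | π ∈ heckeAtoms z ∧ ∀ σ ∈ heckeAtoms z, len π ≤ len σ}

theorem finite_atoms {n : ℕ} [NeZero n] (z : AffInvol n) : (atoms z).Finite := by
  by_cases h : (atoms z).Nonempty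
  · obtain ⟨σ, hσ⟩ := h
    exact (finite_len_le n (len σ)).subset fun π hπ => hπ.2 σ hσ.1
  · rw [Set.not_nonempty_iff_eq_empty.1 h]; exact Set.finite_empty

/-- The affine involution Stanley symmetric function `F̂_z`, the sum of `F_π` over the atoms `π` of
`z`. -/
def involStanley {n : ℕ} [NeZero n] (z : AffInvol n) : QSym :=
  ∑ π ∈ (finite_atoms z).toFinset, stanley π

/-- The linear map `ℚ Ĩ_n → QSym` with `z ↦ F̂_z`. -/
def involStanleyMap (n : ℕ) [NeZero n] : (AffInvol n →₀ ℚ) →ₗ[ℚ] QSym :=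
  Finsupp.linearCombination ℚ involStanley

/-- `ℓ'(π)`: the number `n` minus the number of orbits of `π` on `ℤ/nℤ`. -/
def absLen {n : ℕ} [NeZero n] (π : AffPerm n) : ℕ :=
  n - Nat.card (Quotient (Equiv.Perm.SameCycle.setoid (residuePerm π)))

/-- `ℓ̂(z) = (ℓ(z) + ℓ'(z)) / 2`. -/
def involLen {n : ℕ} [NeZero n] (z : AffInvol n) : ℚ := ((len z.1 : ℚ) + absLen z.1) / 2

/-- The homogeneous component of degree `k` of `ℚ Ĩ_n`, spanned by the `z` with `ℓ̂(z) = k`. -/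
def involDegree (n : ℕ) [NeZero n] (k : ℕ) : Submodule ℚ (AffInvol n →₀ ℚ) :=
  Finsupp.supported ℚ ℚ {z | involLen z = k}

/-- The pairs `(y, π)` with `ℓ̂(z) = ℓ̂(y) + ℓ(π)` and `z = π⁻¹ ∘ y ∘ π`. -/
def coactionPairs {n : ℕ} [NeZero n] (z : AffInvol n) : Set (AffInvol n × AffPerm n) :=
  {p | involLen z = involLen p.1 + len p.2 ∧ z.1 = demazure (demazure p.2⁻¹ p.1.1) p.2}

theorem finite_coactionPairs {n : ℕ} [NeZero n] (z : AffInvol n) : (coactionPairs z).Finite := by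
  obtain ⟨L, hL⟩ := exists_nat_gt (2 * involLen z)
  have h1 : {y : AffInvol n | len y.1 ≤ L}.Finite :=
    Set.Finite.preimage Subtype.val_injective.injOn (finite_len_le n L)
  refine (h1.prod (finite_len_le n L)).subset ?_
  rintro ⟨y, π⟩ ⟨h, -⟩
  simp only [involLen] at h hL
  have h2 : (0 : ℚ) ≤ absLen y.1 := Nat.cast_nonneg _
  have h3 : (0 : ℚ) ≤ len y.1 := Nat.cast_nonneg _
  have h4 : (0 : ℚ) ≤ len π := Nat.cast_nonneg _
  constructor
  · have : (len y.1 : ℚ) ≤ L := by linarith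
    exact_mod_cast this
  · have : (len π : ℚ) ≤ L := by linarith
    exact_mod_cast this

/-- The coaction `Δ̂ : ℚ Ĩ_n → ℚ Ĩ_n ⊗ ℚ S̃_n`, with `Δ̂(z) = ∑ y ⊗ π` over the pairs `(y, π)` with
`ℓ̂(z) = ℓ̂(y) + ℓ(π)` and `z = π⁻¹ ∘ y ∘ π`. -/
def hatDelta (n : ℕ) [NeZero n] :
    (AffInvol n →₀ ℚ) →ₗ[ℚ] (AffInvol n →₀ ℚ) ⊗[ℚ] (AffPerm n →₀ ℚ) :=
  Finsupp.linearCombination ℚ fun z => ∑ p ∈ (finite_coactionPairs z).toFinset,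
    Finsupp.single p.1 (1 : ℚ) ⊗ₜ[ℚ] Finsupp.single p.2 (1 : ℚ)

/-- The coaction of the quasi-symmetric functions on `ℚ Ĩ_n`: `Δ̂` followed by `π ↦ F_π` in the
second factor. -/
def coaction (n : ℕ) [NeZero n] : (AffInvol n →₀ ℚ) →ₗ[ℚ] (AffInvol n →₀ ℚ) ⊗[ℚ] QSym :=
  (stanleyMap n).lTensor (AffInvol n →₀ ℚ) ∘ₗ hatDelta n

end AffineStanley

end

open AffineStanley

/-! Everything rests on two facts: how the relation `(y, π) ∈ P(z)` behaves under products, and what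
the coproduct does to `F_π`.

Write `y · π` for `π⁻¹ ∘ y ∘ π`. Once `∘` is known to be associative and compatible with inversion,
this is a right action of the Demazure monoid on involutions. Acting by `s_i` fixes `y` at a descent
`i` and raises `ℓ̂` by exactly one at an ascent (`involLen_conj_simple`), so `ℓ̂(y · π) ≤ ℓ̂(y) +
ℓ(π)`, and `P(z)` records the cases of equality. Squeezing with this inequality and `ℓ(u ∘ v) ≤ ℓ(u)
+ ℓ(v)` shows that a chain of pairs from `y` through `x` to `z` by `u` and `v` is the same as a pair
`(y, uv)` in `P(z)` with `ℓ(uv) = ℓ(u) + ℓ(v)` (`coactionPairs_mul`, `coactionPairs_of_mul`). The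
atoms of `z` are the `π` with `(1, π) ∈ P(z)` (`mem_atoms_iff`).

On the other side, `F_π` is the sum of `M_α` over length-additive factorizations of `π` into
nontrivial cyclically decreasing elements, `α` being the sequence of lengths. Deconcatenation cuts
such a factorization in two, so `Δ(F_π)` is the sum of `F_u ⊗ F_v` over the reduced factorizations
`π = uv` (`comul_stanley`). With the correspondence above this gives coassociativity of the coaction
and, for chains starting at `1`, the formula for `Δ(F̂_z)`.

For uniqueness, apply the counit to the first factor of the comodule identity: a morphism `φ`
satisfies `φ(z) = ∑ ε(φ(y)) F_π` over `P(z)`. As `φ` is graded and only `1` has degree zero, `ε ∘ φ`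
is determined by `φ(1)`.

The Demazure product is handled through ascents: `len` increases under right multiplication by `s_i`
exactly when `π(i) < π(i + 1)`. From this the left and right steps commute
(`leftStep_demazureStep`), whence independence of the reduced word and associativity. -/

noncomputable section

namespace AffineStanley

/-! ### Length, descents and the Demazure product -/

section Length

variable {n : ℕ}

theorem simpleFun_of_eq {i j : ℤ} (h : (j : ZMod n) = (i : ZMod n)) : simpleFun n i j = j + 1 := by
  simp [simpleFun, h]

theorem simpleFun_of_eq_succ (hn : 2 ≤ n) {i j : ℤ} (h : (j : ZMod n) = ((i + 1 : ℤ) : ZMod n)) :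
    simpleFun n i j = j - 1 := by
  have : (j : ZMod n) ≠ (i : ZMod n) := by rw [h]; exact (cast_ne_succ hn i).symm
  rw [simpleFun, if_neg this, if_pos h]

theorem simpleFun_of_ne {i j : ℤ} (h : (j : ZMod n) ≠ (i : ZMod n))
    (h' : (j : ZMod n) ≠ ((i + 1 : ℤ) : ZMod n)) : simpleFun n i j = j := by
  rw [simpleFun, if_neg h, if_neg h']

variable [NeZero n]

/-- For `n = 1` the shift condition reads `π(i + 1) = π(i) + 1`, so there are no descents. This
disposes of the degenerate case wherever the argument needs `i` and `i + 1` to be distinct residues.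
-/
theorem subsingleton_of_lt_two (hn : ¬ 2 ≤ n) : Subsingleton (AffPerm n) := by
  have h1 : n = 1 := by have := NeZero.ne n; omega
  have h : ∀ π : AffPerm n, π = 1 := fun π => eq_one_of_no_descent π fun i => by
    have := π.2.1 i
    simp only [h1, Nat.cast_one] at this
    omega
  exact ⟨fun a b => (h a).trans (h b).symm⟩

theorem simple_inv (i : ℤ) : (simple n i)⁻¹ = simple n i :=
  inv_eq_of_mul_eq_one_left (simple_mul_self i)

theorem wordProd_cons (i : ℤ) (w : List ℤ) : wordProd n (i :: w) = simple n i * wordProd n w := by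
  simp [wordProd]

theorem wordProd_concat (w : List ℤ) (i : ℤ) :
    wordProd n (w ++ [i]) = wordProd n w * simple n i := by
  simp [wordProd]

theorem wordProd_reverse (w : List ℤ) : wordProd n w.reverse = (wordProd n w)⁻¹ := by
  induction w with
  | nil => simp [wordProd]
  | cons a w ih => rw [List.reverse_cons, wordProd_concat, wordProd_cons, ih, mul_inv_rev, simple_inv]

theorem len_inv (π : AffPerm n) : len π⁻¹ = len π := by
  have key : ∀ σ : AffPerm n, len σ⁻¹ ≤ len σ := fun σ => by
    obtain ⟨w, rfl, hl⟩ := exists_isReduced σ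
    rw [← wordProd_reverse, ← hl, ← List.length_reverse (as := w)]
    exact len_wordProd_le _
  have := key π⁻¹
  rw [inv_inv] at this
  exact le_antisymm (key π) this

theorem mul_apply (σ τ : AffPerm n) (x : ℤ) : (σ * τ).1 x = σ.1 (τ.1 x) := rfl

theorem inv_apply_eq_iff {π : AffPerm n} {a b : ℤ} : π⁻¹.1 a = b ↔ π.1 b = a := by
  change (π.1)⁻¹ a = b ↔ _
  rw [Equiv.Perm.inv_eq_iff_eq, eq_comm]

theorem apply_inv_apply (π : AffPerm n) (a : ℤ) : π.1 (π⁻¹.1 a) = a := inv_apply_eq_iff.1 rfl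

theorem inv_apply_apply (π : AffPerm n) (a : ℤ) : π⁻¹.1 (π.1 a) = a := inv_apply_eq_iff.2 rfl

theorem cast_apply_eq_iff (π : AffPerm n) {a b : ℤ} :
    ((π.1 a : ℤ) : ZMod n) = ((π.1 b : ℤ) : ZMod n) ↔ (a : ZMod n) = (b : ZMod n) :=
  residue_injective π.2.1

/-- The conjugate of `s_i` by `p` exchanges `p(i)` and `p(i + 1)`, together with their translates.
If these are adjacent integers starting in the class of `j`, that conjugate is `s_j`. -/
theorem simple_mul_eq_mul_simple {p : AffPerm n} {i j : ℤ}
    (h : p.1 (i + 1) = p.1 i + 1) (hj : ((p.1 i : ℤ) : ZMod n) = (j : ZMod n)) :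
    simple n j * p = p * simple n i := by
  by_cases hn : 2 ≤ n
  swap
  · have := subsingleton_of_lt_two hn
    exact Subsingleton.elim _ _
  have hj' : ((p.1 (i + 1) : ℤ) : ZMod n) = ((j + 1 : ℤ) : ZMod n) := by
    rw [h]; push_cast; rw [hj]
  apply Subtype.ext; apply Equiv.ext; intro x
  rw [mul_apply, mul_apply, simple_apply hn, simple_apply hn]
  have hper : ∀ y : ℤ, (fun x => p.1 x - x) (y + n) = (fun x => p.1 x - x) y := fun y => by
    simp only [p.2.1]; ring
  by_cases h1 : (x : ZMod n) = (i : ZMod n)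
  · rw [simpleFun_of_eq h1, simpleFun_of_eq (((cast_apply_eq_iff p).2 h1).trans hj)]
    have e1 := periodic_congr (g := fun x => p.1 x - x) hper h1
    have e2 := periodic_congr (g := fun x => p.1 x - x) hper (i := x + 1) (j := i + 1) (by push_cast; rw [h1])
    omega
  by_cases h2 : (x : ZMod n) = ((i + 1 : ℤ) : ZMod n)
  · rw [simpleFun_of_eq_succ hn h2, simpleFun_of_eq_succ hn (((cast_apply_eq_iff p).2 h2).trans hj')]
    have e1 := periodic_congr (g := fun x => p.1 x - x) hper h2
    have e2 := periodic_congr (g := fun x => p.1 x - x) hper (i := x - 1) (j := i) (by push_cast at h2 ⊢; rw [h2]; ring)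
    omega
  · rw [simpleFun_of_ne h1 h2, simpleFun_of_ne]
    · rw [← hj]; exact fun h => h1 ((cast_apply_eq_iff p).1 h)
    · rw [← hj']; exact fun h => h2 ((cast_apply_eq_iff p).1 h)

/-- A generator `s_j` reverses the order of `a < b` only if `b = a + 1` and `a ≡ j`. -/
theorem eq_of_simple_reverses (hn : 2 ≤ n) {j a b : ℤ} (hab : a < b)
    (h : (simple n j).1 b < (simple n j).1 a) : b = a + 1 ∧ (a : ZMod n) = (j : ZMod n) := by
  rw [simple_apply hn, simple_apply hn] at h
  unfold simpleFun at h
  split_ifs at h <;> first | omega | exact ⟨by omega, by assumption⟩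

/-- The exchange property: at a descent `i` of `s_{i_1} ⋯ s_{i_l}`, multiplication by `s_i` amounts to
omitting one of the letters. -/
theorem exists_shorter_word (hn : 2 ≤ n) {i : ℤ} (w : List ℤ)
    (h : (wordProd n w).1 (i + 1) < (wordProd n w).1 i) :
    ∃ v : List ℤ, wordProd n v = wordProd n w * simple n i ∧ v.length + 1 = w.length := by
  induction w with
  | nil => simp [wordProd] at h
  | cons j w ih =>
    by_cases hw : (wordProd n w).1 (i + 1) < (wordProd n w).1 i
    · obtain ⟨v, hv, hl⟩ := ih hw
      exact ⟨j :: v, by rw [wordProd_cons, wordProd_cons, hv, mul_assoc], by simpa using hl⟩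
    -- Here the letter `j` itself creates the descent, so it moves past the remaining word and
    -- becomes `s_i`; it is the letter to omit.
    · have hne : (wordProd n w).1 (i + 1) ≠ (wordProd n w).1 i := fun h => by
        have := (wordProd n w).1.injective h; omega
      rw [wordProd_cons, mul_apply, mul_apply] at h
      obtain ⟨h1, h2⟩ := eq_of_simple_reverses hn (by omega) h
      refine ⟨w, ?_, by simp⟩
      rw [wordProd_cons, simple_mul_eq_mul_simple h1 h2, mul_assoc, simple_mul_self, mul_one]

/-- The exchange property shortens a reduced word by one letter, and a single generator cannot lower
the length by more than one. -/
theorem len_mul_simple_of_gt {π : AffPerm n} {i : ℤ} (h : π.1 (i + 1) < π.1 i) :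
    len (π * simple n i) + 1 = len π := by
  have hn : 2 ≤ n := by
    by_contra hn
    have := subsingleton_of_lt_two hn
    rw [Subsingleton.elim π 1] at h
    simp at h
  obtain ⟨w, rfl, hl⟩ := exists_isReduced π
  obtain ⟨v, hv, hv'⟩ := exists_shorter_word hn w h
  have h1 := len_wordProd_le (n := n) v
  have h2 := len_mul_le (wordProd n w * simple n i) (wordProd n [i])
  have h3 := len_wordProd_le (n := n) [i]
  have h4 : wordProd n [i] = simple n i := by simp [wordProd]
  rw [h4, mul_assoc, simple_mul_self, mul_one] at h2
  rw [h4] at h3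
  rw [hv] at h1
  simp only [List.length_singleton] at h3
  omega

theorem apply_succ_ne (π : AffPerm n) (i : ℤ) : π.1 (i + 1) ≠ π.1 i := fun h => by
  have := π.1.injective h; omega

theorem simple_self (hn : 2 ≤ n) (i : ℤ) : (simple n i).1 i = i + 1 := by
  rw [simple_apply hn, simpleFun_of_eq rfl]

theorem simple_succ (hn : 2 ≤ n) (i : ℤ) : (simple n i).1 (i + 1) = i := by
  rw [simple_apply hn, simpleFun_of_eq_succ hn rfl]; ring

theorem len_mul_simple_of_lt (hn : 2 ≤ n) {π : AffPerm n} {i : ℤ} (h : π.1 i < π.1 (i + 1)) :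
    len (π * simple n i) = len π + 1 := by
  have := len_mul_simple_of_gt (π := π * simple n i) (i := i)
    (by rwa [mul_apply, mul_apply, simple_self hn, simple_succ hn])
  rw [mul_assoc, simple_mul_self, mul_one] at this
  exact this.symm

theorem len_lt_mul_simple_iff (hn : 2 ≤ n) {π : AffPerm n} {i : ℤ} :
    len π < len (π * simple n i) ↔ π.1 i < π.1 (i + 1) := by
  constructor
  · intro h
    by_contra h'
    have := len_mul_simple_of_gt (lt_of_le_of_ne (not_lt.1 h') (apply_succ_ne π i))
    omega
  · intro h
    rw [len_mul_simple_of_lt hn h]; omega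

theorem demazureStep_eq (hn : 2 ≤ n) (π : AffPerm n) (i : ℤ) :
    demazureStep π i = if π.1 i < π.1 (i + 1) then π * simple n i else π := by
  simp only [demazureStep, len_lt_mul_simple_iff hn]

/-- Left multiplication by a generator in the Demazure product. -/
def leftStep (i : ℤ) (π : AffPerm n) : AffPerm n := (demazureStep π⁻¹ i)⁻¹

theorem leftStep_eq (hn : 2 ≤ n) (π : AffPerm n) (i : ℤ) :
    leftStep i π = if π⁻¹.1 i < π⁻¹.1 (i + 1) then simple n i * π else π := by
  rw [leftStep, demazureStep_eq hn]
  split_ifs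
  · rw [mul_inv_rev, inv_inv, simple_inv]
  · rw [inv_inv]

/-- Right multiplication by `s_j` changes the relative position of the values `i, i + 1` only if
these stand at positions exchanged by `s_j`. -/
theorem simple_mul_eq_of_lt_of_not_lt (hn : 2 ≤ n) {π : AffPerm n} {i j : ℤ}
    (h : π⁻¹.1 i < π⁻¹.1 (i + 1)) (h' : ¬ (π * simple n j)⁻¹.1 i < (π * simple n j)⁻¹.1 (i + 1)) :
    simple n i * π = π * simple n j := by
  have hne := apply_succ_ne (π * simple n j)⁻¹ i
  have hinv : (π * simple n j)⁻¹ = simple n j * π⁻¹ := by rw [mul_inv_rev, simple_inv]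
  have hlt : (π * simple n j)⁻¹.1 (i + 1) < (π * simple n j)⁻¹.1 i := by omega
  rw [hinv, mul_apply, mul_apply] at hlt
  obtain ⟨h1, h2⟩ := eq_of_simple_reverses hn h hlt
  have := simple_mul_eq_mul_simple h1 h2
  calc simple n i * π = π * (π⁻¹ * simple n i) * π := by group
    _ = π * simple n j := by rw [← this]; group

/-- Left ascents are insensitive to right multiplication by `s_j`, except when that multiplication
coincides with the left one. One direction is the preceding lemma for `π`, the other the same lemma
for `π s_j`. -/
theorem inv_lt_iff (hn : 2 ≤ n) {π : AffPerm n} {i j : ℤ} (h : simple n i * π ≠ π * simple n j) :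
    (π * simple n j)⁻¹.1 i < (π * simple n j)⁻¹.1 (i + 1) ↔ π⁻¹.1 i < π⁻¹.1 (i + 1) := by
  constructor
  · intro h1
    by_contra h2
    refine h ?_
    have h3 := simple_mul_eq_of_lt_of_not_lt hn (π := π * simple n j) (j := j) h1
      (by rwa [mul_assoc, simple_mul_self, mul_one])
    rw [mul_assoc π, simple_mul_self, mul_one] at h3
    calc simple n i * π = simple n i * (π * simple n j) * simple n j := by
          rw [mul_assoc, mul_assoc, simple_mul_self, mul_one]
      _ = π * simple n j := by rw [h3]
  · intro h1
    by_contra h2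
    exact h (simple_mul_eq_of_lt_of_not_lt hn h1 h2)

theorem lt_iff (hn : 2 ≤ n) {π : AffPerm n} {i j : ℤ} (h : simple n i * π ≠ π * simple n j) :
    (simple n i * π).1 j < (simple n i * π).1 (j + 1) ↔ π.1 j < π.1 (j + 1) := by
  have := inv_lt_iff hn (π := π⁻¹) (i := j) (j := i) (fun h' => h (by
    have := congrArg (·⁻¹) h'
    simpa only [mul_inv_rev, inv_inv, simple_inv] using this.symm))
  rwa [mul_inv_rev, inv_inv, simple_inv] at this

theorem leftStep_eq_len (i : ℤ) (π : AffPerm n) :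
    leftStep i π = if len π < len (simple n i * π) then simple n i * π else π := by
  have : len (π⁻¹ * simple n i) = len (simple n i * π) := by
    rw [← len_inv, mul_inv_rev, inv_inv, simple_inv]
  rw [leftStep, demazureStep, len_inv, this]
  split_ifs
  · rw [mul_inv_rev, inv_inv, simple_inv]
  · rw [inv_inv]

theorem demazureStep_idem (π : AffPerm n) (i : ℤ) :
    demazureStep (demazureStep π i) i = demazureStep π i := by
  unfold demazureStep
  split_ifs with _ h2
  · rw [mul_assoc, simple_mul_self, mul_one] at h2
    omega
  · rfl
  · rfl

theorem leftStep_idem (i : ℤ) (π : AffPerm n) : leftStep i (leftStep i π) = leftStep i π := by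
  simp only [leftStep, inv_inv, demazureStep_idem]

/-- The commutation on which the Demazure product rests. If `s_i π = π s_j`, both steps produce the
longer of `π` and `π s_j`, and idempotence finishes. Otherwise neither step affects the ascent
condition of the other, and the four cases agree by associativity of the group product. -/
theorem leftStep_demazureStep (i j : ℤ) (π : AffPerm n) :
    leftStep i (demazureStep π j) = demazureStep (leftStep i π) j := by
  by_cases hn : 2 ≤ n
  swap
  · have := subsingleton_of_lt_two hn
    exact Subsingleton.elim _ _
  by_cases h : simple n i * π = π * simple n j
  · have h1 : leftStep i π = demazureStep π j := by rw [leftStep_eq_len, h, demazureStep]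
    rw [h1, demazureStep_idem, ← h1, leftStep_idem]
  · rw [leftStep_eq hn, demazureStep_eq hn, demazureStep_eq hn, leftStep_eq hn]
    have e1 := inv_lt_iff hn h
    have e2 := lt_iff hn h
    by_cases h1 : π.1 j < π.1 (j + 1) <;> by_cases h2 : π⁻¹.1 i < π⁻¹.1 (i + 1)
    · simp only [h1, h2, if_true, e1.2 h2, e2.2 h1, mul_assoc]
    · simp only [h1, h2, if_true, if_false, mt e1.1 h2]
    · simp only [h1, h2, if_true, if_false, mt e2.1 h1]
    · simp only [h1, h2, if_false]

theorem leftStep_foldl (i : ℤ) (w : List ℤ) (π : AffPerm n) :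
    leftStep i (w.foldl demazureStep π) = w.foldl demazureStep (leftStep i π) := by
  induction w generalizing π with
  | nil => rfl
  | cons j w ih => rw [List.foldl_cons, List.foldl_cons, ih, leftStep_demazureStep]

theorem foldr_foldl (v w : List ℤ) (π : AffPerm n) :
    v.foldr leftStep (w.foldl demazureStep π) = w.foldl demazureStep (v.foldr leftStep π) := by
  induction v with
  | nil => rfl
  | cons i v ih => rw [List.foldr_cons, List.foldr_cons, ih, leftStep_foldl]

theorem isReduced_of_length {w : List ℤ} (h : w.length ≤ len (wordProd n w)) :
    IsReduced w (wordProd n w) := ⟨rfl, le_antisymm h (len_wordProd_le w)⟩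

theorem isReduced_concat {w : List ℤ} {i : ℤ} {π : AffPerm n} (h : IsReduced (w ++ [i]) π) :
    IsReduced w (wordProd n w) ∧ len π = len (wordProd n w) + 1 := by
  obtain ⟨rfl, hl⟩ := h
  have h1 := len_mul_le (wordProd n w) (wordProd n [i])
  rw [← wordProd_append, ← hl] at h1
  have h2 := len_wordProd_le (n := n) w
  have h3 := len_wordProd_le (n := n) [i]
  simp only [List.length_append, List.length_singleton] at *
  exact ⟨isReduced_of_length (by omega), by omega⟩

theorem foldl_one_of_isReduced {w : List ℤ} {π : AffPerm n} (h : IsReduced w π) :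
    w.foldl demazureStep 1 = π := by
  induction w using List.reverseRecOn generalizing π with
  | nil => simpa [wordProd] using h.1
  | append_singleton w i ih =>
    obtain ⟨h1, h2⟩ := isReduced_concat h
    obtain ⟨rfl, hl⟩ := h
    rw [List.foldl_append, List.foldl_cons, List.foldl_nil, ih h1, demazureStep,
      ← wordProd_concat, if_pos (by omega)]

theorem isReduced_reverse {w : List ℤ} {π : AffPerm n} (h : IsReduced w π) :
    IsReduced w.reverse π⁻¹ :=
  ⟨by rw [wordProd_reverse, h.1], by rw [List.length_reverse, h.2, len_inv]⟩

theorem foldr_leftStep (w : List ℤ) (π : AffPerm n) :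
    w.foldr leftStep π = (w.reverse.foldl demazureStep π⁻¹)⁻¹ := by
  induction w with
  | nil => simp
  | cons i w ih => rw [List.foldr_cons, ih, leftStep, inv_inv, List.reverse_cons, List.foldl_append]; rfl

theorem foldr_one_of_isReduced {w : List ℤ} {π : AffPerm n} (h : IsReduced w π) :
    w.foldr leftStep 1 = π := by
  rw [foldr_leftStep, inv_one, foldl_one_of_isReduced (isReduced_reverse h), inv_inv]

/-- Independence of the reduced word. Build `u` from `1` by left steps; these commute with the right
steps, so the right steps may act on `1` first, where any reduced word of `v` gives `v`. -/
theorem demazure_eq_foldl {w : List ℤ} {v : AffPerm n} (h : IsReduced w v) (u : AffPerm n) :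
    demazure u v = w.foldl demazureStep u := by
  obtain ⟨a, ha⟩ := exists_isReduced u
  rw [demazure, ← foldr_one_of_isReduced ha, ← foldr_foldl, ← foldr_foldl,
    foldl_one_of_isReduced h, foldl_one_of_isReduced (Classical.choose_spec (exists_isReduced v))]

theorem demazure_eq_foldr {w : List ℤ} {u : AffPerm n} (h : IsReduced w u) (v : AffPerm n) :
    demazure u v = w.foldr leftStep v := by
  obtain ⟨a, ha⟩ := exists_isReduced v
  rw [demazure_eq_foldl ha, ← foldr_one_of_isReduced h, ← foldr_foldl, foldl_one_of_isReduced ha]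

/-- Demazure multiplication by `u` on the left is a sequence of left steps, by `w` on the right a
sequence of right steps, and the two commute. -/
theorem demazure_assoc (u v w : AffPerm n) :
    demazure (demazure u v) w = demazure u (demazure v w) := by
  obtain ⟨a, ha⟩ := exists_isReduced u
  obtain ⟨b, hb⟩ := exists_isReduced w
  rw [demazure_eq_foldr ha, demazure_eq_foldr ha, demazure_eq_foldl hb, demazure_eq_foldl hb,
    foldr_foldl]

theorem demazure_one (u : AffPerm n) : demazure u 1 = u :=
  demazure_eq_foldl (w := []) ⟨rfl, len_one.symm⟩ u

theorem one_demazure (u : AffPerm n) : demazure 1 u = u :=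
  demazure_eq_foldr (w := []) ⟨rfl, len_one.symm⟩ u

theorem len_simple (hn : 2 ≤ n) (i : ℤ) : len (simple n i) = 1 := by
  have := len_mul_simple_of_lt (n := n) hn (π := 1) (i := i) (by simp)
  rwa [one_mul, len_one] at this

theorem demazure_simple (u : AffPerm n) (i : ℤ) : demazure u (simple n i) = demazureStep u i := by
  by_cases hn : 2 ≤ n
  · exact demazure_eq_foldl (w := [i]) ⟨by simp [wordProd], by simp [len_simple hn]⟩ u
  · have := subsingleton_of_lt_two hn
    exact Subsingleton.elim _ _

theorem foldl_demazureStep_of_len (w : List ℤ) (u : AffPerm n)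
    (h : len (u * wordProd n w) = len u + w.length) :
    w.foldl demazureStep u = u * wordProd n w := by
  induction w using List.reverseRecOn with
  | nil => simp [wordProd]
  | append_singleton w i ih =>
    have h1 := len_mul_le (u * wordProd n w) (wordProd n [i])
    rw [mul_assoc, ← wordProd_append, h] at h1
    have h2 := len_mul_le u (wordProd n w)
    have h3 := len_wordProd_le (n := n) [i]
    have h4 := len_wordProd_le (n := n) w
    simp only [List.length_append, List.length_singleton] at *
    rw [List.foldl_append, ih (by omega), List.foldl_cons, List.foldl_nil, demazureStep, mul_assoc,
      ← wordProd_concat, if_pos (by omega)]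

theorem demazure_of_len {u v : AffPerm n} (h : len (u * v) = len u + len v) :
    demazure u v = u * v := by
  obtain ⟨w, rfl, hl⟩ := exists_isReduced v
  rw [demazure_eq_foldl ⟨rfl, hl⟩]
  exact foldl_demazureStep_of_len w u (by rw [h, hl])

theorem isDemazureProduct_demazure : IsDemazureProduct (demazure (n := n)) where
  assoc := demazure_assoc
  idem i := by
    rw [demazure_simple, demazureStep, if_neg]
    rw [simple_mul_self, len_one]; omega
  mul _ _ := demazure_of_len

/-- The operation `(v⁻¹ ∘ u⁻¹)⁻¹` has the characteristic properties of the Demazure product as well,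
so uniqueness identifies it with `u ∘ v`. -/
theorem demazure_inv (u v : AffPerm n) : (demazure u v)⁻¹ = demazure v⁻¹ u⁻¹ := by
  have h : IsDemazureProduct fun u v : AffPerm n => (demazure v⁻¹ u⁻¹)⁻¹ :=
    { assoc := fun u v w => by simp only [inv_inv, demazure_assoc]
      idem := fun i => by
        rw [simple_inv, isDemazureProduct_demazure.idem, simple_inv]
      mul := fun u v h => by
        rw [demazure_of_len, mul_inv_rev, inv_inv, inv_inv]
        rw [← mul_inv_rev, len_inv, len_inv, len_inv, h, add_comm] }
  have : (demazure v⁻¹ u⁻¹)⁻¹ = demazure u v := congrFun (congrFun h.eq_demazure u) v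
  rw [← this, inv_inv]

/-- Each step either multiplies by its letter, adding at most one to the length, or does nothing.
Reaching the maximal length therefore forces every step to multiply. -/
theorem len_foldl_demazureStep (w : List ℤ) (u : AffPerm n) :
    len (w.foldl demazureStep u) ≤ len u + w.length ∧
      (len (w.foldl demazureStep u) = len u + w.length →
        w.foldl demazureStep u = u * wordProd n w) := by
  induction w using List.reverseRecOn with
  | nil => simp [wordProd]
  | append_singleton w i ih =>
    simp only [List.foldl_append, List.foldl_cons, List.foldl_nil, List.length_append,
      List.length_singleton]
    generalize List.foldl demazureStep u w = x at ih
    have h1 := len_mul_le x (wordProd n [i])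
    have h2 := len_wordProd_le (n := n) [i]
    have h3 : wordProd n [i] = simple n i := by simp [wordProd]
    rw [h3] at h1 h2
    rw [List.length_singleton] at h2
    unfold demazureStep
    split_ifs
    · refine ⟨by omega, fun h => ?_⟩
      rw [ih.2 (by omega), wordProd_concat, mul_assoc]
    · exact ⟨by omega, fun h => by omega⟩

theorem len_demazure_le (u v : AffPerm n) : len (demazure u v) ≤ len u + len v := by
  obtain ⟨w, hw⟩ := exists_isReduced v
  rw [demazure_eq_foldl hw, ← hw.2]
  exact (len_foldl_demazureStep w u).1

theorem demazure_eq_mul {u v : AffPerm n} (h : len (demazure u v) = len u + len v) :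
    demazure u v = u * v := by
  obtain ⟨w, hw⟩ := exists_isReduced v
  have := len_foldl_demazureStep w u
  rw [demazure_eq_foldl hw, ← hw.2] at h
  rw [demazure_eq_foldl hw, this.2 h, hw.1]

/-- Induction on the length: an element is trivial or a longer product `σ s_i`. -/
theorem len_induction {P : AffPerm n → Prop} (one : P 1)
    (step : ∀ (σ : AffPerm n) (i : ℤ), len (σ * simple n i) = len σ + 1 → P σ → P (σ * simple n i))
    (π : AffPerm n) : P π := by
  obtain ⟨w, hw⟩ := exists_isReduced π
  induction w using List.reverseRecOn generalizing π with
  | nil => rw [← hw.1]; exact one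
  | append_singleton w i ih =>
    obtain ⟨h1, h2⟩ := isReduced_concat hw
    rw [← hw.1, wordProd_concat] at h2 ⊢
    exact step _ _ h2 (ih _ h1)

end Length

/-! ### Affine involutions, the statistic `ℓ̂` and atoms -/

section Involutions

/-- For an involution, twice the number of orbits is the number of points plus the number of fixed
points. -/
theorem two_mul_card_orbits {α : Type*} [Fintype α] [DecidableEq α] (σ : Equiv.Perm α)
    (hσ : ∀ a, σ (σ a) = a) :
    2 * Nat.card (Quotient (Equiv.Perm.SameCycle.setoid σ)) =
      Fintype.card α + (Finset.univ.filter fun a => σ a = a).card := by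
  classical
  have hrel : ∀ a b, Equiv.Perm.SameCycle σ a b ↔ b = a ∨ b = σ a := by
    intro a b
    have hsq : σ ^ 2 = 1 := by ext x; simp [pow_two, hσ]
    constructor
    · rintro ⟨i, rfl⟩
      obtain ⟨k, rfl | rfl⟩ := Int.even_or_odd' i
      · left
        rw [zpow_mul, zpow_ofNat, hsq]; simp
      · right
        rw [zpow_add, zpow_mul, zpow_ofNat, hsq]; simp
    · rintro (rfl | rfl)
      · exact Equiv.Perm.SameCycle.refl _ _
      · exact ⟨1, by simp⟩
  let q : α → Quotient (Equiv.Perm.SameCycle.setoid σ) := Quotient.mk _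
  -- Weight fixed points by two and other points by one: every orbit then has total weight two.
  have hfib : ∀ c, ∑ a ∈ Finset.univ.filter (fun a => q a = c), (1 + if σ a = a then 1 else 0) = 2 := by
    intro c
    obtain ⟨b, rfl⟩ := Quotient.exists_rep c
    have : Finset.univ.filter (fun a => q a = Quotient.mk _ b) = {b, σ b} := by
      ext a
      simp only [Finset.mem_filter, Finset.mem_univ, true_and, Finset.mem_insert,
        Finset.mem_singleton, q]
      rw [← hrel, eq_comm]
      exact Quotient.eq
    rw [this]
    by_cases h : σ b = b
    · simp [h]
    · rw [Finset.sum_pair (Ne.symm h)]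
      simp [hσ, h, Ne.symm h]
  have := Finset.sum_fiberwise Finset.univ q (fun a => 1 + if σ a = a then 1 else 0)
  rw [Finset.sum_congr rfl fun c _ => hfib c, Finset.sum_add_distrib, Finset.sum_boole] at this
  rw [Nat.card_eq_fintype_card]
  simpa [mul_comm] using this

variable {n : ℕ} [NeZero n]

/-- The number of fixed points on `ℤ/nℤ`. -/
def fixedCard (π : AffPerm n) : ℕ := (Finset.univ.filter fun r => residuePerm π r = r).card

theorem two_mul_absLen (z : AffInvol n) : 2 * absLen z.1 + fixedCard z.1 = n := by
  have h := two_mul_card_orbits (residuePerm z.1) (fun r => by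
    obtain ⟨i, rfl⟩ := ZMod.intCast_surjective r
    rw [residuePerm_coe, residuePerm_coe]
    congr 1
    nth_rw 1 [z.2]
    exact inv_apply_apply _ _)
  -- This bounds the number of orbits by `n`, so that the truncated subtraction in `absLen` is a
  -- genuine one.
  have h2 : fixedCard z.1 ≤ n := (Finset.card_filter_le _ _).trans (by simp [ZMod.card])
  rw [ZMod.card] at h
  rw [fixedCard] at *
  rw [absLen]
  omega

theorem fixedCard_conj (π σ : AffPerm n) : fixedCard (σ * π * σ⁻¹) = fixedCard π := by
  symm
  refine Finset.card_bij (fun r _ => residuePerm σ r) ?_ ?_ ?_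
  · intro r hr
    obtain ⟨i, rfl⟩ := ZMod.intCast_surjective r
    simp only [Finset.mem_filter, Finset.mem_univ, true_and, residuePerm_coe, mul_apply,
      inv_apply_apply, cast_apply_eq_iff] at hr ⊢
    exact hr
  · intro r _ s _ h
    exact (residuePerm σ).injective h
  · intro r hr
    obtain ⟨i, rfl⟩ := ZMod.intCast_surjective r
    refine ⟨((σ⁻¹.1 i : ℤ) : ZMod n), ?_, by rw [residuePerm_coe, apply_inv_apply]⟩
    simp only [Finset.mem_filter, Finset.mem_univ, true_and, residuePerm_coe, mul_apply] at hr ⊢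
    rw [← cast_apply_eq_iff σ, hr, apply_inv_apply]

theorem fixedCard_mul_simple (hn : 2 ≤ n) {π : AffPerm n} {i : ℤ}
    (h : ((π.1 i : ℤ) : ZMod n) = (i : ZMod n))
    (h' : ((π.1 (i + 1) : ℤ) : ZMod n) = ((i + 1 : ℤ) : ZMod n)) :
    fixedCard π = fixedCard (π * simple n i) + 2 := by
  have hne := cast_ne_succ hn i
  have e0 : residuePerm (π * simple n i) (i : ZMod n) = ((i + 1 : ℤ) : ZMod n) := by
    rw [residuePerm_coe, mul_apply, simple_self hn, h']
  have e1 : residuePerm (π * simple n i) ((i + 1 : ℤ) : ZMod n) = (i : ZMod n) := by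
    rw [residuePerm_coe, mul_apply, simple_succ hn, h]
  have : (Finset.univ.filter fun r => residuePerm π r = r) =
      insert (i : ZMod n) (insert ((i + 1 : ℤ) : ZMod n)
        (Finset.univ.filter fun r => residuePerm (π * simple n i) r = r)) := by
    ext r
    simp only [Finset.mem_filter, Finset.mem_univ, true_and, Finset.mem_insert]
    by_cases h1 : r = i
    · subst h1
      simp [residuePerm_coe, h]
    by_cases h2 : r = ((i + 1 : ℤ) : ZMod n)
    · subst h2
      simp only [residuePerm_coe, h', true_or, or_true]
    · simp only [h1, h2, false_or]
      obtain ⟨j, rfl⟩ := ZMod.intCast_surjective r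
      rw [residuePerm_coe, residuePerm_coe, mul_apply, simple_apply hn, simpleFun_of_ne h1 h2]
  rw [fixedCard, this, Finset.card_insert_of_notMem, Finset.card_insert_of_notMem]
  · rfl
  · simp only [Finset.mem_filter, Finset.mem_univ, true_and, e1]; exact hne
  · simp only [Finset.mem_filter, Finset.mem_univ, true_and, Finset.mem_insert, e0, not_or]
    exact ⟨hne, hne.symm⟩

/-- The involution `π⁻¹ ∘ y ∘ π`. -/
def AffInvol.conj (y : AffInvol n) (π : AffPerm n) : AffInvol n :=
  ⟨demazure (demazure π⁻¹ y.1) π, by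
    rw [demazure_inv, demazure_inv, inv_inv, ← y.2, demazure_assoc]⟩

theorem AffInvol.conj_one (y : AffInvol n) : y.conj 1 = y := by
  apply Subtype.ext
  simp only [AffInvol.conj, inv_one, one_demazure, demazure_one]

theorem AffInvol.conj_conj (y : AffInvol n) (u v : AffPerm n) :
    (y.conj u).conj v = y.conj (demazure u v) := by
  apply Subtype.ext
  simp only [AffInvol.conj, demazure_inv, demazure_assoc]

theorem AffInvol.conj_simple_val (y : AffInvol n) (i : ℤ) :
    (y.conj (simple n i)).1 = leftStep i (demazureStep y.1 i) := by
  simp only [AffInvol.conj]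
  rw [demazure_simple, leftStep_demazureStep, leftStep, ← demazure_simple y.1⁻¹, demazure_inv,
    inv_inv]

theorem AffInvol.conj_simple_of_gt (hn : 2 ≤ n) {y : AffInvol n} {i : ℤ}
    (h : ¬ y.1.1 i < y.1.1 (i + 1)) : y.conj (simple n i) = y := by
  apply Subtype.ext
  rw [conj_simple_val, demazureStep_eq hn, if_neg h, leftStep_eq hn, ← y.2, if_neg h]

theorem AffInvol.conj_simple_of_comm (hn : 2 ≤ n) {y : AffInvol n} {i : ℤ}
    (h : y.1.1 i < y.1.1 (i + 1)) (hc : simple n i * y.1 = y.1 * simple n i) :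
    (y.conj (simple n i)).1 = y.1 * simple n i := by
  rw [conj_simple_val, demazureStep_eq hn, if_pos h, leftStep_eq_len, ← hc, ← mul_assoc,
    simple_mul_self, one_mul, if_neg]
  rw [hc, len_mul_simple_of_lt hn h]
  omega

theorem AffInvol.conj_simple_of_not_comm (hn : 2 ≤ n) {y : AffInvol n} {i : ℤ}
    (h : y.1.1 i < y.1.1 (i + 1)) (hc : simple n i * y.1 ≠ y.1 * simple n i) :
    (y.conj (simple n i)).1 = simple n i * (y.1 * simple n i) ∧
      len (simple n i * (y.1 * simple n i)) = len y.1 + 2 := by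
  have h1 : (y.1 * simple n i)⁻¹.1 i < (y.1 * simple n i)⁻¹.1 (i + 1) := by
    rw [inv_lt_iff hn hc, ← y.2]; exact h
  constructor
  · rw [conj_simple_val, demazureStep_eq hn, if_pos h, leftStep_eq hn, if_pos h1]
  · have h2 := len_mul_simple_of_lt hn h1
    rw [← len_inv, mul_inv_rev, inv_inv, simple_inv, len_inv, len_mul_simple_of_lt hn h] at h2
    omega

/-- Commutation gives `s_i(y(i)) = y(i + 1) > y(i)`, and `s_i` raises only the integers congruent to
`i`. -/
theorem fixed_of_comm (hn : 2 ≤ n) {y : AffPerm n} {i : ℤ}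
    (h : y.1 i < y.1 (i + 1)) (hc : simple n i * y = y * simple n i) :
    ((y.1 i : ℤ) : ZMod n) = (i : ZMod n) ∧
      ((y.1 (i + 1) : ℤ) : ZMod n) = ((i + 1 : ℤ) : ZMod n) := by
  have h1 : (simple n i).1 (y.1 i) = y.1 (i + 1) := by
    rw [← mul_apply, hc, mul_apply, simple_self hn]
  rw [simple_apply hn, simpleFun] at h1
  split_ifs at h1 with h2 h3
  · exact ⟨h2, by rw [← h1]; push_cast; rw [h2]⟩
  · omega
  · omega

/-- In either case `ℓ + ℓ'` grows by two. If `s_i` commutes with `y`, the result is `y s_i`: the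
length grows by one, and two fixed residues merge into one orbit. Otherwise it is `s_i y s_i`: the
length grows by two, and conjugation preserves the number of fixed residues. -/
theorem involLen_conj_simple (hn : 2 ≤ n) {y : AffInvol n} {i : ℤ} (h : y.1.1 i < y.1.1 (i + 1)) :
    involLen (y.conj (simple n i)) = involLen y + 1 := by
  have a1 := two_mul_absLen y
  have a2 := two_mul_absLen (y.conj (simple n i))
  suffices len (y.conj (simple n i)).1 + absLen (y.conj (simple n i)).1 =
      len y.1 + absLen y.1 + 2 by
    rw [involLen, involLen, ← Nat.cast_add, this]; push_cast; ring
  by_cases hc : simple n i * y.1 = y.1 * simple n i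
  · obtain ⟨h1, h2⟩ := fixed_of_comm hn h hc
    have h3 := fixedCard_mul_simple hn h1 h2
    rw [AffInvol.conj_simple_of_comm hn h hc] at a2 ⊢
    rw [len_mul_simple_of_lt hn h]
    omega
  · obtain ⟨h1, h2⟩ := AffInvol.conj_simple_of_not_comm hn h hc
    have h3 := fixedCard_conj y.1 (simple n i)
    rw [simple_inv, mul_assoc] at h3
    rw [h1] at a2 ⊢
    omega

theorem involLen_conj_le (y : AffInvol n) (π : AffPerm n) :
    involLen (y.conj π) ≤ involLen y + len π := by
  by_cases hn : 2 ≤ n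
  swap
  · have := subsingleton_of_lt_two hn
    rw [Subsingleton.elim (y.conj π) y]
    simp
  induction π using len_induction with
  | one => rw [y.conj_one]; simp
  | step σ i h ih =>
    have h1 : demazure σ (simple n i) = σ * simple n i :=
      demazure_of_len (by rw [h, len_simple hn])
    rw [← h1, ← AffInvol.conj_conj, h1, h]
    push_cast
    by_cases hlt : (y.conj σ).1.1 i < (y.conj σ).1.1 (i + 1)
    · rw [involLen_conj_simple hn hlt]; linarith
    · rw [AffInvol.conj_simple_of_gt hn hlt]; linarith

/-- A nontrivial `z` has a descent `i`. Undoing the step there gives `y = z s_i` or `y = s_i z s_i`,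
according to whether `s_i` and `z` commute. -/
theorem exists_conj_simple {z : AffInvol n} (hz : z ≠ AffInvol.one n) :
    ∃ (y : AffInvol n) (i : ℤ), z = y.conj (simple n i) ∧ len y.1 < len z.1 ∧
      involLen z = involLen y + 1 := by
  by_cases hn : 2 ≤ n
  swap
  · have := subsingleton_of_lt_two hn
    exact absurd (Subsingleton.elim _ _) hz
  obtain ⟨i, hi⟩ : ∃ i, z.1.1 (i + 1) < z.1.1 i := by
    by_contra! h
    exact hz (Subtype.ext (eq_one_of_no_descent z.1 fun i =>
      lt_of_le_of_ne (h i) (apply_succ_ne z.1 i).symm))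
  have hlen := len_mul_simple_of_gt hi
  have hzs : (z.1 * simple n i).1 i < (z.1 * simple n i).1 (i + 1) := by
    rwa [mul_apply, mul_apply, simple_self hn, simple_succ hn]
  by_cases hc : simple n i * z.1 = z.1 * simple n i
  · set y : AffInvol n := ⟨z.1 * simple n i, by rw [mul_inv_rev, simple_inv, ← z.2, hc]⟩
    have hy : y.1 = z.1 * simple n i := rfl
    have e : z = y.conj (simple n i) := by
      apply Subtype.ext
      rw [AffInvol.conj_simple_of_comm hn hzs]
      · rw [hy, mul_assoc, simple_mul_self, mul_one]
      · rw [hy, ← mul_assoc, hc]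
    refine ⟨y, i, e, by rw [hy]; omega, ?_⟩
    nth_rw 1 [e]
    exact involLen_conj_simple hn hzs
  · set y : AffInvol n := ⟨simple n i * (z.1 * simple n i), by
      rw [mul_inv_rev, mul_inv_rev, simple_inv, ← z.2, mul_assoc]⟩
    have hy : y.1 = simple n i * (z.1 * simple n i) := rfl
    have hys : y.1 * simple n i = simple n i * z.1 := by
      rw [hy, mul_assoc, mul_assoc, simple_mul_self, mul_one]
    have hsy : simple n i * y.1 = z.1 * simple n i := by
      rw [hy, ← mul_assoc, simple_mul_self, one_mul]
    have hlt : y.1.1 i < y.1.1 (i + 1) := by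
      refine (lt_iff hn (fun h => hc ?_)).2 hzs
      rw [← mul_assoc, mul_assoc z.1, simple_mul_self, mul_one] at h
      rw [← hys, hy, ← mul_assoc, h]
    obtain ⟨h1, h2⟩ := AffInvol.conj_simple_of_not_comm hn hlt
      (by rw [hys, hsy]; exact fun h => hc h.symm)
    have h3 : simple n i * (y.1 * simple n i) = z.1 := by
      rw [hys, ← mul_assoc, simple_mul_self, one_mul]
    rw [h3] at h1 h2
    have e : z = y.conj (simple n i) := Subtype.ext h1.symm
    refine ⟨y, i, e, by omega, ?_⟩
    nth_rw 1 [e]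
    exact involLen_conj_simple hn hlt

theorem involLen_one : involLen (AffInvol.one n) = 0 := by
  have h := two_mul_absLen (AffInvol.one n)
  have h1 : fixedCard (AffInvol.one n).1 = n := by
    have : ∀ r, residuePerm (1 : AffPerm n) r = r := fun r => by
      obtain ⟨i, rfl⟩ := ZMod.intCast_surjective r
      rw [residuePerm_coe]; rfl
    simp [fixedCard, AffInvol.one, this, ZMod.card]
  have h2 : len (AffInvol.one n).1 = 0 := len_one
  rw [involLen, h2, show absLen (AffInvol.one n).1 = 0 by omega]
  simp

theorem mem_coactionPairs {z y : AffInvol n} {π : AffPerm n} :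
    (y, π) ∈ coactionPairs z ↔ involLen z = involLen y + len π ∧ z = y.conj π := by
  rw [Subtype.ext_iff]; rfl

theorem exists_mem_coactionPairs (z : AffInvol n) :
    ∃ π, (AffInvol.one n, π) ∈ coactionPairs z := by
  induction h : len z.1 using Nat.strong_induction_on generalizing z with
  | _ k ih =>
    by_cases hz : z = AffInvol.one n
    · subst hz
      exact ⟨1, mem_coactionPairs.2 ⟨by simp [len_one], (AffInvol.conj_one _).symm⟩⟩
    obtain ⟨y, i, h1, h2, h3⟩ := exists_conj_simple hz
    obtain ⟨σ, hσ⟩ := ih _ (h ▸ h2) y rfl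
    obtain ⟨h4, h5⟩ := mem_coactionPairs.1 hσ
    have h6 : z = (AffInvol.one n).conj (demazure σ (simple n i)) := by
      rw [← AffInvol.conj_conj, ← h5]; exact h1
    -- Both bounds meet: `ℓ̂(z) ≤ ℓ(σ ∘ s_i) ≤ ℓ(σ) + 1 = ℓ̂(z)`.
    refine ⟨_, mem_coactionPairs.2 ⟨le_antisymm ?_ ?_, h6⟩⟩
    · nth_rw 1 [h6]
      exact involLen_conj_le _ _
    · have h7 := len_demazure_le σ (simple n i)
      have h8 := len_wordProd_le (n := n) [i]
      rw [show wordProd n [i] = simple n i by simp [wordProd], List.length_singleton] at h8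
      have h9 : (len (demazure σ (simple n i)) : ℚ) ≤ len σ + 1 := by exact_mod_cast (by omega)
      linarith

theorem exists_involLen_eq (z : AffInvol n) : ∃ k : ℕ, involLen z = k := by
  obtain ⟨π, hπ⟩ := exists_mem_coactionPairs z
  exact ⟨len π, by rw [(mem_coactionPairs.1 hπ).1, involLen_one, zero_add]⟩

theorem eq_one_of_involLen {z : AffInvol n} (h : involLen z = 0) : z = AffInvol.one n := by
  obtain ⟨π, hπ⟩ := exists_mem_coactionPairs z
  obtain ⟨h1, h2⟩ := mem_coactionPairs.1 hπ
  rw [h, involLen_one, zero_add] at h1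
  rw [h2, eq_one_of_len_eq_zero (π := π) (by exact_mod_cast h1.symm), AffInvol.conj_one]

/-- `ℓ̂(z)` is a lower bound for the length of every Hecke atom and is attained, so minimal length
means length `ℓ̂(z)`. -/
theorem mem_atoms_iff {z : AffInvol n} {π : AffPerm n} :
    π ∈ atoms z ↔ (AffInvol.one n, π) ∈ coactionPairs z := by
  have hmem : ∀ σ, σ ∈ heckeAtoms z ↔ z = (AffInvol.one n).conj σ := fun σ => by
    rw [Subtype.ext_iff]
    simp only [heckeAtoms, AffInvol.conj, AffInvol.one, demazure_one, Set.mem_ofPred_eq, eq_comm]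
  have hle : ∀ σ ∈ heckeAtoms z, involLen z ≤ len σ := fun σ hσ => by
    have := involLen_conj_le (AffInvol.one n) σ
    rwa [← (hmem σ).1 hσ, involLen_one, zero_add] at this
  rw [mem_coactionPairs, involLen_one, zero_add, ← hmem]
  constructor
  · rintro ⟨h1, h2⟩
    obtain ⟨σ, hσ⟩ := exists_mem_coactionPairs z
    rw [mem_coactionPairs, involLen_one, zero_add, ← hmem] at hσ
    refine ⟨le_antisymm (hle _ h1) ?_, h1⟩
    rw [hσ.1]
    exact_mod_cast h2 σ hσ.2
  · rintro ⟨h1, h2⟩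
    refine ⟨h2, fun σ hσ => ?_⟩
    have := hle σ hσ
    rw [h1] at this
    exact_mod_cast this

/-- Since `ℓ(u) + ℓ(v) = ℓ̂(z) - ℓ̂(y) ≤ ℓ(u ∘ v) ≤ ℓ(u) + ℓ(v)`, equality holds throughout, and
then `u ∘ v = u v`. -/
theorem coactionPairs_mul {x y z : AffInvol n} {u v : AffPerm n} (h : (x, v) ∈ coactionPairs z)
    (h' : (y, u) ∈ coactionPairs x) :
    (y, u * v) ∈ coactionPairs z ∧ len u + len v = len (u * v) := by
  rw [mem_coactionPairs] at *
  obtain ⟨h1, rfl⟩ := h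
  obtain ⟨h2, rfl⟩ := h'
  have h3 := involLen_conj_le y (demazure u v)
  have h4 := len_demazure_le u v
  rw [← AffInvol.conj_conj] at h3
  have h5 : (len u + len v : ℚ) ≤ len (demazure u v) := by linarith
  have h6 : len (demazure u v) = len u + len v := le_antisymm h4 (by exact_mod_cast h5)
  have h7 := demazure_eq_mul h6
  rw [AffInvol.conj_conj, h7] at h1 ⊢
  rw [h7] at h6
  refine ⟨⟨?_, rfl⟩, h6.symm⟩
  rw [h1, h2, h6]; push_cast; ring

/-- The converse: acting by `u` and then by `v` raises `ℓ̂` by at most `ℓ(u)` and `ℓ(v)`. The total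
rise is `ℓ(u) + ℓ(v)`, so both bounds are attained. -/
theorem coactionPairs_of_mul {y z : AffInvol n} {u v : AffPerm n}
    (h : (y, u * v) ∈ coactionPairs z) (hl : len u + len v = len (u * v)) :
    (y.conj u, v) ∈ coactionPairs z ∧ (y, u) ∈ coactionPairs (y.conj u) := by
  simp only [mem_coactionPairs] at *
  obtain ⟨h1, h2⟩ := h
  rw [← demazure_of_len hl.symm, ← AffInvol.conj_conj] at h2
  have h3 := involLen_conj_le y u
  have h4 := involLen_conj_le (y.conj u) v
  rw [← h2, h1, ← hl] at h4
  push_cast at h4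
  have h5 : involLen (y.conj u) = involLen y + len u := by linarith
  refine ⟨⟨?_, h2⟩, h5, trivial⟩
  rw [h1, h5, ← hl]; push_cast; ring

end Involutions

/-! ### Gradings and the coproduct of affine Stanley functions -/

section QuasiSymmetric

/-- A partition of the index set of a basis defines a grading. -/
theorem isInternal_comap_supported {ι R M : Type*} [CommRing R] [AddCommGroup M]
    [Module R M] (e : M ≃ₗ[R] (ι →₀ R)) (S : ℕ → Set ι)
    (hdisj : Pairwise fun i j => Disjoint (S i) (S j)) (hS : ∀ a, ∃ k, a ∈ S k)
    {ℳ : ℕ → Submodule R M} (hℳ : ∀ k m, m ∈ ℳ k ↔ e m ∈ Finsupp.supported R R (S k)) :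
    DirectSum.IsInternal ℳ := by
  have hmap : ∀ k, ℳ k = Submodule.orderIsoMapComap e.symm (Finsupp.supported R R (S k)) := by
    intro k
    ext m
    rw [hℳ]
    simp [Submodule.mem_map_equiv]
  have hind : iSupIndep fun k => Finsupp.supported R R (S k) := by
    intro k
    rw [iSup_subtype', ← Finsupp.supported_iUnion]
    refine Finsupp.disjoint_supported_supported ?_
    rw [Set.disjoint_iUnion_right]
    exact fun j => hdisj j.2.symm
  refine DirectSum.isInternal_submodule_of_iSupIndep_of_iSup_eq_top ?_ ?_
  · rw [funext hmap]
    exact hind.map_orderIso (Submodule.orderIsoMapComap e.symm)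
  · rw [funext hmap, ← OrderIso.map_iSup, ← Finsupp.supported_iUnion,
      Set.iUnion_eq_univ_iff.2 hS, Finsupp.supported_univ]
    exact map_top _

/-- The degree of a composition. -/
def compDegree (α : List ℕ+) : ℕ := (α.map PNat.val).sum

theorem mem_qsymDegree {k : ℕ} {f : QSym} :
    f ∈ qsymDegree k ↔ qsymEquiv f ∈ Finsupp.supported ℚ ℚ {α | compDegree α = k} := by
  rw [Finsupp.mem_supported]
  constructor
  · intro h α hα
    have := h (stdExp α) (Finsupp.mem_support_iff.1 hα)
    rwa [← compress_sum, compress_stdExp] at this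
  · intro h d hd
    have h1 : MvPowerSeries.coeff (stdExp (compress d)) f.1 ≠ 0 := by
      rwa [f.2.2 _ _ (compress_stdExp (compress d))]
    have := h (Finsupp.mem_support_iff.2 h1)
    rwa [← compress_sum]

theorem qsymBasis_mem_degree (α : List ℕ+) : qsymBasis α ∈ qsymDegree (compDegree α) := by
  intro d hd
  rw [coeff_qsymBasis] at hd
  have : compress d = α := by by_contra h; simp [h] at hd
  rw [← compress_sum, this, compDegree]

theorem isInternal_qsymDegree : DirectSum.IsInternal qsymDegree := by
  refine isInternal_comap_supported qsymEquiv (fun k => {α | compDegree α = k}) ?_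
    (fun α => ⟨_, rfl⟩) fun k f => mem_qsymDegree
  intro i j hij
  exact Set.disjoint_left.2 fun α h1 h2 => hij (h1.symm.trans h2)

/-- A linear map out of a space with basis, which maps basis elements of degree `k` into a submodule,
maps everything of degree `k` there. -/
theorem map_mem_of_supported {ι R M N : Type*} [CommRing R] [AddCommGroup M] [Module R M]
    [AddCommGroup N] [Module R N] (b : Module.Basis ι R M) (S : Set ι) (φ : M →ₗ[R] N)
    (P : Submodule R N) (h : ∀ i ∈ S, φ (b i) ∈ P) {m : M} (hm : b.repr m ∈ Finsupp.supported R R S) :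
    φ m ∈ P := by
  rw [← b.linearCombination_repr m, Finsupp.linearCombination_apply, Finsupp.sum, map_sum]
  refine Submodule.sum_mem _ fun i hi => ?_
  rw [map_smul]
  exact P.smul_mem _ (h i (hm hi))

theorem tmul_mem_graded {R M N : Type*} [CommRing R] [AddCommGroup M] [Module R M]
    [AddCommGroup N] [Module R N] {ℳ : ℕ → Submodule R M} {𝒩 : ℕ → Submodule R N} {i j k : ℕ}
    (hk : i + j = k) {x : M} {y : N} (hx : x ∈ ℳ i) (hy : y ∈ 𝒩 j) :
    x ⊗ₜ[R] y ∈ ⨆ p ∈ Finset.HasAntidiagonal.antidiagonal k,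
      LinearMap.range (TensorProduct.map (ℳ p.1).subtype (𝒩 p.2).subtype) := by
  refine Submodule.mem_iSup_of_mem (i, j) (Submodule.mem_iSup_of_mem (by simpa using hk) ?_)
  exact ⟨⟨x, hx⟩ ⊗ₜ ⟨y, hy⟩, by simp⟩

theorem isGradedRightComodule_qsym : IsGradedRightComodule qsymDegree qsymDegree
    (CoalgebraStruct.comul (R := ℚ) (A := QSym)) where
  isInternal := isInternal_qsymDegree
  coassoc := Coalgebra.coassoc
  counit := Coalgebra.lTensor_counit_comp_comul
  graded k f hf := by
    refine map_mem_of_supported (N := QSym ⊗[ℚ] QSym) qsymBasis {α | compDegree α = k}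
      CoalgebraStruct.comul _ (fun α hα => ?_) (mem_qsymDegree.1 hf)
    rw [comul_qsymBasis]
    refine Submodule.sum_mem _ fun i _ => ?_
    refine tmul_mem_graded ?_ (qsymBasis_mem_degree _) (qsymBasis_mem_degree _)
    rw [← show compDegree α = k from hα]
    nth_rw 3 [← List.take_append_drop i α]
    simp only [compDegree, List.map_append, List.sum_append]

variable {n : ℕ} [NeZero n]

/-- The sequence of lengths of nontrivial elements. -/
def lens (l : List (AffPerm n)) : List ℕ+ := l.map fun σ => (len σ).toPNat'

/-- The length-additive factorizations of `π` into nontrivial cyclically decreasing elements. -/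
def factLists (π : AffPerm n) : Set (List (AffPerm n)) :=
  {l | (∀ σ ∈ l, IsCyclicallyDecreasing σ ∧ 0 < len σ) ∧ l.prod = π ∧ (l.map len).sum = len π}

/-- `toPNat'` sends `0` to `1`, so `lens` is faithful only on lists of nontrivial elements;
positivity of the lengths has to be carried along. -/
theorem map_len_eq_iff {l : List (AffPerm n)} {α : List ℕ+} :
    l.map len = α.map PNat.val ↔ (∀ σ ∈ l, 0 < len σ) ∧ lens l = α := by
  constructor
  · intro h
    have h1 : ∀ σ ∈ l, 0 < len σ := fun σ hσ => by
      have : len σ ∈ α.map PNat.val := h ▸ List.mem_map_of_mem hσ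
      obtain ⟨a, _, ha⟩ := List.mem_map.1 this
      rw [← ha]
      exact a.pos
    refine ⟨h1, List.map_injective_iff.2 PNat.coe_injective ?_⟩
    rw [← h, lens, List.map_map]
    refine List.map_congr_left fun σ hσ => ?_
    simp [h1 σ hσ]
  · rintro ⟨h1, rfl⟩
    rw [lens, List.map_map]
    refine List.map_congr_left fun σ hσ => ?_
    simp [h1 σ hσ]

theorem finite_factLists (π : AffPerm n) : (factLists π).Finite := by
  have hfin := (finite_len_le n (len π)).to_subtype
  refine ((List.finite_length_le {σ : AffPerm n | len σ ≤ len π} (len π)).image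
    (List.map Subtype.val)).subset ?_
  rintro l ⟨h1, -, h3⟩
  have h4 : ∀ σ ∈ l, len σ ∈ l.map len := fun σ hσ => List.mem_map_of_mem hσ
  refine ⟨l.attach.map fun σ => ⟨σ.1, ?_⟩, ?_, ?_⟩
  · rw [Set.mem_ofPred_eq, ← h3]
    exact List.single_le_sum (fun _ _ => Nat.zero_le _) _ (h4 σ.1 σ.2)
  · rw [Set.mem_ofPred_eq, List.length_map, List.length_attach]
    have := List.card_nsmul_le_sum (l.map len) 1 fun x hx => by
      obtain ⟨σ, hσ, rfl⟩ := List.mem_map.1 hx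
      exact (h1 σ hσ).2
    simpa [h3] using this
  · rw [List.map_map]
    exact List.attach_map_subtype_val l

/-- Discarding the trivial factors turns a factorization with exponent `d` into a list whose lengths
are `compress d`. Each list thus contributes one monomial for every `d` with that compression, that
is, one `M_α`. -/
theorem stanley_eq_sum (π : AffPerm n) :
    stanley π = ∑ l ∈ (finite_factLists π).toFinset, qsymBasis (lens l) := by
  apply Subtype.ext
  ext d
  rw [AddSubmonoidClass.coe_finsetSum, map_sum]
  simp only [coeff_qsymBasis]
  rw [Finset.sum_boole]
  change MvPowerSeries.coeff d (stanleySeries π) = _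
  rw [coeff_stanleySeries, card_factorization, ← Set.ncard_coe_finset]
  congr 2
  ext l
  simp only [Finset.coe_filter, Set.Finite.mem_toFinset, Set.mem_ofPred_eq, map_len_eq_iff, factLists]
  constructor
  · rintro ⟨⟨h1, h2⟩, h3, h4, h5⟩
    refine ⟨⟨fun σ hσ => ⟨h3 σ hσ, h1 σ hσ⟩, h4, ?_⟩, h2.symm⟩
    rw [(map_len_eq_iff (α := compress d)).2 ⟨h1, h2⟩, h5]
  · rintro ⟨⟨h1, h2, h3⟩, h4⟩
    have h5 := (map_len_eq_iff (α := compress d)).2 ⟨fun σ hσ => (h1 σ hσ).2, h4.symm⟩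
    exact ⟨⟨fun σ hσ => (h1 σ hσ).2, h4.symm⟩, fun σ hσ => (h1 σ hσ).1, h2, by rw [← h5, h3]⟩

theorem compDegree_lens {π : AffPerm n} {l : List (AffPerm n)} (hl : l ∈ factLists π) :
    compDegree (lens l) = len π := by
  rw [compDegree, ← map_len_eq_iff.2 ⟨fun σ hσ => (hl.1 σ hσ).2, rfl⟩, hl.2.2]

theorem stanley_mem_degree (π : AffPerm n) : stanley π ∈ qsymDegree (len π) := by
  rw [stanley_eq_sum]
  refine Submodule.sum_mem _ fun l hl => ?_
  rw [← compDegree_lens ((Set.Finite.mem_toFinset _).1 hl)]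
  exact qsymBasis_mem_degree _

theorem counit_of_mem_degree {k : ℕ} (hk : k ≠ 0) {f : QSym} (hf : f ∈ qsymDegree k) :
    CoalgebraStruct.counit (R := ℚ) f = 0 := by
  rw [← Submodule.mem_bot ℚ]
  refine map_mem_of_supported qsymBasis {α | compDegree α = k} _ _ ?_ (mem_qsymDegree.1 hf)
  intro α hα
  rw [counit_qsymBasis, if_neg, Submodule.mem_bot]
  rintro rfl
  exact hk hα.symm

theorem factLists_one : factLists (1 : AffPerm n) = {[]} := by
  ext l
  simp only [Set.mem_singleton_iff]
  constructor
  · rintro ⟨h1, _, h3⟩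
    rw [len_one] at h3
    by_contra hl
    obtain ⟨σ, hσ⟩ := List.exists_mem_of_ne_nil l hl
    have := (h1 σ hσ).2
    have := List.single_le_sum (fun _ _ => Nat.zero_le _) _ (List.mem_map_of_mem (f := len) hσ)
    omega
  · rintro rfl
    exact ⟨by simp, by simp, by simp [len_one]⟩

theorem stanley_one : stanley (1 : AffPerm n) = qsymBasis [] := by
  have h : (finite_factLists (1 : AffPerm n)).toFinset = {[]} := by
    ext l; rw [Set.Finite.mem_toFinset, factLists_one]; simp
  rw [stanley_eq_sum, h, Finset.sum_singleton]
  rfl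

theorem counit_stanley_one : CoalgebraStruct.counit (R := ℚ) (stanley (1 : AffPerm n)) = 1 := by
  rw [stanley_one, counit_qsymBasis, if_pos rfl]

theorem counit_stanley_of_ne {π : AffPerm n} (h : π ≠ 1) :
    CoalgebraStruct.counit (R := ℚ) (stanley π) = 0 :=
  counit_of_mem_degree (fun h' => h (eq_one_of_len_eq_zero h')) (stanley_mem_degree π)

/-- The pairs `(u, v)` with `π = u v` and `ℓ(u) + ℓ(v) = ℓ(π)`. -/
def reducedPairs (π : AffPerm n) : Set (AffPerm n × AffPerm n) :=
  {p | p.1 * p.2 = π ∧ len p.1 + len p.2 = len π}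

theorem finite_reducedPairs (π : AffPerm n) : (reducedPairs π).Finite := by
  refine ((finite_len_le n (len π)).prod (finite_len_le n (len π))).subset ?_
  rintro ⟨u, v⟩ ⟨-, h⟩
  simp only [Set.mem_prod, Set.mem_ofPred_eq] at h ⊢
  omega

theorem len_prod_le (l : List (AffPerm n)) : len l.prod ≤ (l.map len).sum := by
  induction l with
  | nil => simp [len_one]
  | cons a l ih =>
    rw [List.prod_cons, List.map_cons, List.sum_cons]
    exact (len_mul_le _ _).trans (by omega)

/-- Length is subadditive on each half and on the product of the halves. Additivity for the whole
list is therefore equivalent to additivity in all three places. -/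
theorem append_mem_factLists {π : AffPerm n} {a b : List (AffPerm n)} :
    a ++ b ∈ factLists π ↔
      (a.prod, b.prod) ∈ reducedPairs π ∧ a ∈ factLists a.prod ∧ b ∈ factLists b.prod := by
  have h1 := len_prod_le a
  have h2 := len_prod_le b
  have h3 := len_mul_le a.prod b.prod
  simp only [factLists, reducedPairs, Set.mem_ofPred_eq, List.prod_append, List.map_append,
    List.sum_append, List.forall_mem_append]
  constructor
  · rintro ⟨⟨h4, h5⟩, rfl, h7⟩
    exact ⟨⟨rfl, by omega⟩, ⟨h4, trivial, by omega⟩, h5, trivial, by omega⟩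
  · rintro ⟨⟨rfl, h4⟩, ⟨h5, -, h6⟩, h7, -, h8⟩
    exact ⟨⟨h5, h7⟩, rfl, by omega⟩

/-- A term on the left is a factorization with a cut position; the products of the two pieces give a
reduced pair `(u, v)`, and the pieces are factorizations of `u` and `v`. -/
theorem comul_stanley (π : AffPerm n) : CoalgebraStruct.comul (R := ℚ) (stanley π) =
    ∑ p ∈ (finite_reducedPairs π).toFinset, stanley p.1 ⊗ₜ[ℚ] stanley p.2 := by
  simp only [stanley_eq_sum, map_sum, comul_qsymBasis, TensorProduct.sum_tmul,
    TensorProduct.tmul_sum]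
  simp only [← Finset.sum_product']
  rw [Finset.sum_sigma', Finset.sum_sigma']
  refine Finset.sum_nbij'
    -- The inner pair lists the factorization of `v` before that of `u`, in the order of the
    -- expanded double sum.
    (fun q => ⟨((q.1.take q.2).prod, (q.1.drop q.2).prod), (q.1.drop q.2, q.1.take q.2)⟩)
    (fun q => ⟨q.2.2 ++ q.2.1, q.2.2.length⟩) ?_ ?_ ?_ ?_ ?_
  · rintro ⟨l, i⟩ h
    simp only [Finset.mem_sigma, Finset.mem_product, Set.Finite.mem_toFinset] at h ⊢
    have := (append_mem_factLists (a := l.take i) (b := l.drop i) (π := π)).1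
      (by rw [List.take_append_drop]; exact h.1)
    tauto
  · rintro ⟨⟨u, v⟩, b, a⟩ h
    simp only [Finset.mem_sigma, Finset.mem_product, Set.Finite.mem_toFinset] at h ⊢
    obtain ⟨h1, h2, h3⟩ := h
    obtain rfl := h2.2.1
    obtain rfl := h3.2.1
    refine ⟨append_mem_factLists.2 ⟨h1, h3, h2⟩, ?_⟩
    simp [lens]
  · rintro ⟨l, i⟩ h
    simp only [Finset.mem_sigma, Finset.mem_range, lens, List.length_map] at h
    simp only [List.take_append_drop, List.length_take]
    rw [min_eq_left (by omega)]
  · rintro ⟨⟨u, v⟩, b, a⟩ h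
    simp only [Finset.mem_sigma, Finset.mem_product, Set.Finite.mem_toFinset] at h
    obtain ⟨h1, h2, h3⟩ := h
    obtain rfl := h2.2.1
    obtain rfl := h3.2.1
    simp
  · rintro ⟨l, i⟩ h
    simp only [lens, List.map_take, List.map_drop]

end QuasiSymmetric

/-! ### The comodule structure, the coproduct formula and uniqueness -/

section Comodule

variable {n : ℕ} [NeZero n]

theorem coaction_single (z : AffInvol n) : coaction n (Finsupp.single z 1) =
    ∑ p ∈ (finite_coactionPairs z).toFinset,
      Finsupp.single p.1 (1 : ℚ) ⊗ₜ[ℚ] stanley p.2 := by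
  simp only [coaction, hatDelta, stanleyMap, LinearMap.comp_apply,
    Finsupp.linearCombination_single, one_smul, map_sum, LinearMap.lTensor_tmul]

theorem involStanleyMap_single (z : AffInvol n) :
    involStanleyMap n (Finsupp.single z 1) = involStanley z := by
  rw [involStanleyMap, Finsupp.linearCombination_single, one_smul]

theorem involStanley_mem_degree {z : AffInvol n} {k : ℕ} (hk : involLen z = k) :
    involStanley z ∈ qsymDegree k := by
  refine Submodule.sum_mem _ fun π hπ => ?_
  have h := (mem_coactionPairs.1 (mem_atoms_iff.1 ((Set.Finite.mem_toFinset _).1 hπ))).1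
  rw [involLen_one, zero_add, hk] at h
  rw [show k = len π by exact_mod_cast h]
  exact stanley_mem_degree π

theorem involStanley_one : involStanley (AffInvol.one n) = qsymBasis [] := by
  have h : (finite_atoms (AffInvol.one n)).toFinset = {1} := by
    ext π
    rw [Set.Finite.mem_toFinset, mem_atoms_iff, mem_coactionPairs, Finset.mem_singleton]
    constructor
    · rintro ⟨h, -⟩
      exact eq_one_of_len_eq_zero (by simpa using h)
    · rintro rfl
      exact ⟨by simp [len_one], (AffInvol.conj_one _).symm⟩
  rw [involStanley, h, Finset.sum_singleton, stanley_one]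

theorem coe_qsymBasis_nil : (qsymBasis [] : MvPowerSeries ℕ ℚ) = 1 := by
  classical
  ext d
  rw [coeff_qsymBasis, MvPowerSeries.coeff_one]
  have : compress d = [] ↔ d = 0 := by
    constructor
    · intro h
      rw [← Finsupp.degree_eq_zero_iff, ← compress_sum, h]
      rfl
    · rintro rfl
      simp [compress]
  simp only [this]

/-- Splitting an atom of `z` as a reduced product `u v` is the same as choosing `(y, v) ∈ P(z)` and
an atom `u` of `y`, where `y = u⁻¹ ∘ u`. -/
theorem comul_involStanley (z : AffInvol n) : CoalgebraStruct.comul (R := ℚ) (involStanley z) =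
    ∑ p ∈ (finite_coactionPairs z).toFinset, involStanley p.1 ⊗ₜ[ℚ] stanley p.2 := by
  simp only [involStanley, map_sum, comul_stanley, TensorProduct.sum_tmul]
  rw [Finset.sum_sigma', Finset.sum_sigma']
  refine Finset.sum_nbij' (fun q => ⟨((AffInvol.one n).conj q.2.1, q.2.2), q.2.1⟩)
    (fun q => ⟨q.2 * q.1.2, (q.2, q.1.2)⟩) ?_ ?_ ?_ ?_ ?_
  · rintro ⟨π, u, v⟩ h
    simp only [Finset.mem_sigma, Set.Finite.mem_toFinset, mem_atoms_iff] at h ⊢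
    obtain ⟨h1, rfl, h2⟩ := h
    exact coactionPairs_of_mul h1 h2
  · rintro ⟨⟨y, v⟩, u⟩ h
    simp only [Finset.mem_sigma, Set.Finite.mem_toFinset, mem_atoms_iff] at h ⊢
    obtain ⟨h1, h2⟩ := coactionPairs_mul h.1 h.2
    exact ⟨h1, rfl, h2⟩
  · rintro ⟨π, u, v⟩ h
    simp only [Finset.mem_sigma, Set.Finite.mem_toFinset, mem_atoms_iff] at h
    obtain ⟨h1, rfl, h2⟩ := h
    rfl
  · rintro ⟨⟨y, v⟩, u⟩ h
    simp only [Finset.mem_sigma, Set.Finite.mem_toFinset, mem_atoms_iff] at h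
    rw [← (mem_coactionPairs.1 h.2).2]
  · rintro ⟨π, u, v⟩ h
    rfl

theorem coaction_coassoc : (TensorProduct.assoc ℚ (AffInvol n →₀ ℚ) QSym QSym).toLinearMap ∘ₗ
    (coaction n).rTensor QSym ∘ₗ coaction n =
    (CoalgebraStruct.comul (R := ℚ) (A := QSym)).lTensor (AffInvol n →₀ ℚ) ∘ₗ coaction n := by
  refine Finsupp.basisSingleOne.ext fun z => ?_
  simp only [Finsupp.coe_basisSingleOne, LinearMap.comp_apply, coaction_single, map_sum,
    LinearMap.rTensor_tmul, LinearMap.lTensor_tmul, comul_stanley, TensorProduct.sum_tmul,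
    TensorProduct.tmul_sum, LinearEquiv.coe_coe, TensorProduct.assoc_tmul]
  rw [Finset.sum_sigma', Finset.sum_sigma']
  -- Chains `(x, v) ∈ P(z)`, `(y, u) ∈ P(x)` correspond to pairs `(y, u v) ∈ P(z)` with a reduced
  -- splitting; the intermediate involution is recovered as `x = u⁻¹ ∘ y ∘ u`.
  refine Finset.sum_nbij' (fun q => ⟨(q.2.1, q.2.2 * q.1.2), (q.2.2, q.1.2)⟩)
    (fun q => ⟨(q.1.1.conj q.2.1, q.2.2), (q.1.1, q.2.1)⟩) ?_ ?_ ?_ ?_ ?_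
  · rintro ⟨⟨x, v⟩, y, u⟩ h
    simp only [Finset.mem_sigma, Set.Finite.mem_toFinset] at h ⊢
    obtain ⟨h1, h2⟩ := coactionPairs_mul h.1 h.2
    exact ⟨h1, rfl, h2⟩
  · rintro ⟨⟨y, π⟩, u, v⟩ h
    simp only [Finset.mem_sigma, Set.Finite.mem_toFinset] at h ⊢
    obtain ⟨h1, rfl, h2⟩ := h
    exact coactionPairs_of_mul h1 h2
  · rintro ⟨⟨x, v⟩, y, u⟩ h
    simp only [Finset.mem_sigma, Set.Finite.mem_toFinset] at h
    simp only [← (mem_coactionPairs.1 h.2).2]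
  · rintro ⟨⟨y, π⟩, u, v⟩ h
    simp only [Finset.mem_sigma, Set.Finite.mem_toFinset] at h
    obtain ⟨h1, rfl, h2⟩ := h
    rfl
  · rintro ⟨⟨x, v⟩, y, u⟩ h
    rfl

theorem coaction_counit :
    (CoalgebraStruct.counit (R := ℚ) (A := QSym)).lTensor (AffInvol n →₀ ℚ) ∘ₗ coaction n =
      (TensorProduct.mk ℚ (AffInvol n →₀ ℚ) ℚ).flip 1 := by
  refine Finsupp.basisSingleOne.ext fun z => ?_
  simp only [Finsupp.coe_basisSingleOne, LinearMap.comp_apply, coaction_single, map_sum,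
    LinearMap.lTensor_tmul, LinearMap.flip_apply, TensorProduct.mk_apply]
  -- The counit kills `F_π` unless `π = 1`, and `π = 1` forces `y = z`.
  rw [Finset.sum_eq_single (z, 1)]
  · rw [counit_stanley_one]
  · rintro ⟨y, π⟩ hp hne
    rw [Set.Finite.mem_toFinset, mem_coactionPairs] at hp
    rw [counit_stanley_of_ne, TensorProduct.tmul_zero]
    rintro rfl
    exact hne (by rw [hp.2, AffInvol.conj_one])
  · intro h
    refine absurd ((Set.Finite.mem_toFinset _).2 (mem_coactionPairs.2 ⟨?_, ?_⟩)) h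
    · simp [len_one]
    · exact (AffInvol.conj_one z).symm

theorem isInternal_involDegree : DirectSum.IsInternal (involDegree n) := by
  refine isInternal_comap_supported (LinearEquiv.refl ℚ _) (fun k => {z | involLen z = k}) ?_
    exists_involLen_eq fun k m => Iff.rfl
  intro i j hij
  exact Set.disjoint_left.2 fun z h1 h2 => hij (by exact_mod_cast h1.symm.trans h2)

theorem map_mem_of_mem_involDegree {N : Type*} [AddCommGroup N] [Module ℚ N] {k : ℕ}
    (φ : (AffInvol n →₀ ℚ) →ₗ[ℚ] N) (P : Submodule ℚ N)
    (h : ∀ z, involLen z = k → φ (Finsupp.single z 1) ∈ P) {m : AffInvol n →₀ ℚ}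
    (hm : m ∈ involDegree n k) : φ m ∈ P :=
  map_mem_of_supported (Finsupp.basisSingleOne (ι := AffInvol n) (R := ℚ)) {z | involLen z = k} φ P
    (fun z hz => by simpa using h z hz) hm

theorem single_mem_involDegree {z : AffInvol n} {k : ℕ} (h : involLen z = k) :
    Finsupp.single z (1 : ℚ) ∈ involDegree n k :=
  Finsupp.single_mem_supported ℚ _ h

theorem isGradedRightComodule_invol :
    IsGradedRightComodule qsymDegree (involDegree n) (coaction n) where
  isInternal := isInternal_involDegree
  coassoc := coaction_coassoc
  counit := coaction_counit
  graded k m hm := by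
    refine map_mem_of_mem_involDegree (coaction n) _ (fun z hz => ?_) hm
    rw [coaction_single]
    refine Submodule.sum_mem _ fun p hp => ?_
    rw [Set.Finite.mem_toFinset, mem_coactionPairs (y := p.1) (π := p.2)] at hp
    obtain ⟨i, hi⟩ := exists_involLen_eq p.1
    refine tmul_mem_graded ?_ (single_mem_involDegree hi) (stanley_mem_degree p.2)
    have := hp.1
    rw [hz, hi] at this
    exact_mod_cast this.symm

theorem isGradedComoduleHom_involStanleyMap :
    IsGradedComoduleHom (involDegree n) (coaction n) qsymDegree
      (CoalgebraStruct.comul (R := ℚ) (A := QSym)) (involStanleyMap n) where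
  comm := by
    refine Finsupp.basisSingleOne.ext fun z => ?_
    simp only [Finsupp.coe_basisSingleOne, LinearMap.comp_apply, coaction_single, map_sum,
      LinearMap.rTensor_tmul, involStanleyMap_single, comul_involStanley]
  graded k m hm := by
    refine map_mem_of_mem_involDegree _ _ (fun z hz => ?_) hm
    rw [involStanleyMap_single]
    exact involStanley_mem_degree hz

/-- A morphism to the quasi-symmetric functions is determined by its composition with the counit. -/
theorem apply_eq_sum_counit {φ : (AffInvol n →₀ ℚ) →ₗ[ℚ] QSym}
    (h : φ.rTensor QSym ∘ₗ coaction n = CoalgebraStruct.comul (R := ℚ) (A := QSym) ∘ₗ φ)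
    (z : AffInvol n) : φ (Finsupp.single z 1) = ∑ p ∈ (finite_coactionPairs z).toFinset,
      CoalgebraStruct.counit (R := ℚ) (φ (Finsupp.single p.1 1)) • stanley p.2 := by
  -- Applying the counit to the left tensor factor reduces `Δ(φ(z))` to `φ(z)` by the counit law of
  -- `QSym`.
  have h1 := congrArg (TensorProduct.lid ℚ QSym) (congrArg
    ((CoalgebraStruct.counit (R := ℚ) (A := QSym)).rTensor QSym)
    (LinearMap.congr_fun h (Finsupp.single z 1)))
  simp only [LinearMap.comp_apply, Coalgebra.rTensor_counit_comul, coaction_single, map_sum,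
    LinearMap.rTensor_tmul, TensorProduct.lid_tmul, one_smul] at h1
  exact h1.symm

/-- It suffices to compare counits after the two maps. At `1` they agree by normalization; any other
involution has positive degree, where a graded map followed by the counit vanishes. -/
theorem eq_involStanleyMap {φ : (AffInvol n →₀ ℚ) →ₗ[ℚ] QSym}
    (h : IsGradedComoduleHom (involDegree n) (coaction n) qsymDegree
      (CoalgebraStruct.comul (R := ℚ) (A := QSym)) φ)
    (h1 : (φ (Finsupp.single (AffInvol.one n) 1) : MvPowerSeries ℕ ℚ) = 1) :
    φ = involStanleyMap n := by
  have hone : φ (Finsupp.single (AffInvol.one n) 1) = qsymBasis [] :=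
    Subtype.ext (h1.trans coe_qsymBasis_nil.symm)
  have key := isGradedComoduleHom_involStanleyMap (n := n)
  refine Finsupp.basisSingleOne.ext fun z => ?_
  rw [Finsupp.coe_basisSingleOne, apply_eq_sum_counit h.comm, apply_eq_sum_counit key.comm]
  refine Finset.sum_congr rfl fun p _ => ?_
  congr 1
  by_cases hp : p.1 = AffInvol.one n
  · rw [hp, hone, involStanleyMap_single, involStanley_one]
  · obtain ⟨k, hk⟩ := exists_involLen_eq p.1
    have hk0 : k ≠ 0 := by
      rintro rfl
      exact hp (eq_one_of_involLen (by simpa using hk))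
    rw [counit_of_mem_degree hk0 (h.graded k _ (single_mem_involDegree hk)),
      counit_of_mem_degree hk0 (key.graded k _ (single_mem_involDegree hk))]

end Comodule

end AffineStanley

end

theorem proposition3p7 (n : ℕ) [NeZero n] :
    -- `∘` is the associative product with `s_i ∘ s_i = s_i` and `u ∘ v = u v` if lengths add up
    IsDemazureProduct (demazure (n := n)) ∧
    -- `QSym` is a graded right comodule for itself
    IsGradedRightComodule qsymDegree qsymDegree (CoalgebraStruct.comul (R := ℚ) (A := QSym)) ∧
    -- `ℚ Ĩ_n` is a graded right `QSym`-comodule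
    IsGradedRightComodule qsymDegree (involDegree n) (coaction n) ∧
    -- `z ↦ F̂_z` is a morphism of graded right comodules with `1 ↦ 1`
    IsGradedComoduleHom (involDegree n) (coaction n) qsymDegree
      (CoalgebraStruct.comul (R := ℚ) (A := QSym)) (involStanleyMap n) ∧
    (involStanleyMap n (Finsupp.single (AffInvol.one n) 1) : MvPowerSeries ℕ ℚ) = 1 ∧
    -- and it is the only one
    (∀ φ : (AffInvol n →₀ ℚ) →ₗ[ℚ] QSym,
      IsGradedComoduleHom (involDegree n) (coaction n) qsymDegree
        (CoalgebraStruct.comul (R := ℚ) (A := QSym)) φ →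
      (φ (Finsupp.single (AffInvol.one n) 1) : MvPowerSeries ℕ ℚ) = 1 →
      φ = involStanleyMap n) ∧
    -- the coproduct formula
    ∀ z : AffInvol n, CoalgebraStruct.comul (R := ℚ) (involStanley z) =
      ∑ p ∈ (finite_coactionPairs z).toFinset,
        TensorProduct.tmul ℚ (involStanley p.1) (stanley p.2) := by
  exact ⟨isDemazureProduct_demazure, isGradedRightComodule_qsym, isGradedRightComodule_invol,
    isGradedComoduleHom_involStanleyMap,
    by rw [involStanleyMap_single, involStanley_one, coe_qsymBasis_nil],
    fun _ h h1 => eq_involStanleyMap h h1, comul_involStanley⟩
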